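/- **Setting.** Let $\mathcal X=\{1,\dots,k\}$, let $h:\mathcal X\to\mathbb R^d$, let $\Theta\subseteq\mathbb R^p$ and $\alpha:\Theta\to\mathbb R^d$, and for $\theta\in\Theta$ let $$E_\theta=\Bigl\{P:\ P(x)>0\ \ \forall x,\ \ \sum_xP(x)=1,\ \ \sum_x P(x)h(x)=\alpha(\theta)\Bigr\},$$ assumed nonempty for every $\theta\in\Theta$. Let $Q$ be a probability vector on $\mathcal X$ with $Q(x)>0$ for all $x$, write $D(P\|R)=\sum_xP(x)\log\frac{P(x)}{R(x)}$, and let $P^*_\theta=\arg\min_{P\in E_\theta}D(P\|Q)$ be the information projection of $Q$ onto $E_\theta$. Let $P_0$ be any probability vector on $\mathcal X$ (the truth, which need not lie in any $E_\theta$; the case $P_0=Q$, in which the data are drawn from the truth and $P^*_\theta=\arg\min_{P\in E_\theta}D(P\|P_0)$, is included), and let $\theta_0\in\Theta$ be pseudo-true: it minimizes $\theta\mapsto D(P_0\|P^*_\theta)$ over $\Theta$. Let $\mathsf T^*=\{v\in\mathbb R^k:\sum_xv_x=0,\ \sum_xv_xh(x)=0\}$. Assume that $\mathsf T^*\neq\{0\}$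 and that $\mathsf T^*$ is spanned by its integer vectors (as is the case if $h$ is rational valued). Let $H^*_{\theta_0}=\Pi_{\mathsf T^*}\,\mathrm{diag}(1/P^*_{\theta_0})\,\Pi_{\mathsf T^*}$, regarded as an operator on $\mathsf T^*$, where $\Pi_{\mathsf T^*}$ is the Euclidean orthogonal projection onto $\mathsf T^*$, and let $\lambda_{\min}(H^*_{\theta_0})$ be its smallest eigenvalue. Let $X_1,\dots,X_n$ be i.i.d. with law $Q$, let $P_n$ be their empirical measure, and let $E_{\theta_0,n}$ be the set of those members of $E_{\theta_0}$ that are empirical measures of samples of size $n$. For $m\le n$ and $E_{\theta_0,n}\ne\emptyset$ the predictive law on $\mathcal X^m$ is $$\mu_{n,m}(x_{1:m})=\sum_{P\in E_{\theta_0,n}}\Pr(X_{1:m}=x_{1:m}\mid P_n=P)\,\Pr(P_n=P\mid P_n\in E_{\theta_0,n}).$$ **Corollary (predictive misspecification).** There is a constant $C>0$ depending only on $k=|\mathcal X|$ such that, in the setting above, for every sequence $m=m_n$ of non-negative integers with $m_n=o\bigl(\sqrt{n\,\lambda_{\min}(H^*_{\theta_0})/\log n}\bigr)$, $$\bigl\|\mu_{n,m_n}-(P^*_{\theta_0})^{\otimes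 m_n}\bigr\|_{\mathrm{TV}}\ \le\ C\,m_n\sqrt{\frac{\log n}{n\,\lambda_{\min}(H^*_{\theta_0})}}$$ for all sufficiently large $n$ with $E_{\theta_0,n}\neq\emptyset$ (how large may depend on all the data and on the sequence); in particular $\|\mu_{n,m_n}-(P^*_{\theta_0})^{\otimes m_n}\|_{\mathrm{TV}}\to0$ along these $n$. Here the little-$o$ condition, too, is only required along the $n$ with $E_{\theta_0,n}\ne\emptyset$, and $\|\mu-\nu\|_{\mathrm{TV}}=\frac12\sum_y|\mu(y)-\nu(y)|$. -/

import Mathlib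

open Filter Asymptotics

/-! Finite sample space `Fin k`; laws on it are vectors `Fin k → ℝ`. -/

namespace ConstrainedPrediction

noncomputable section

/-- `P` is a probability vector. -/
def IsProb {k : ℕ} (P : Fin k → ℝ) : Prop :=
  (∀ x, 0 ≤ P x) ∧ ∑ x, P x = 1

/-- Kullback--Leibler divergence `D(P ‖ Q)` of two laws on a finite set (with `0 log 0 = 0`);
it is only used with a strictly positive second argument. -/
def kl {k : ℕ} (P Q : Fin k → ℝ) : ℝ :=
  ∑ x, P x * Real.log (P x / Q x)

/-- The constraint set `{P in the open simplex : E_P[h] = a}`. -/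
def constraintSet {k d : ℕ} (h : Fin k → Fin d → ℝ) (a : Fin d → ℝ) : Set (Fin k → ℝ) :=
  {P | (∀ x, 0 < P x) ∧ ∑ x, P x = 1 ∧ ∑ x, P x • h x = a}

/-- `P` minimizes `D(· ‖ Q)` over `E`. -/
def IsInfoProj {k : ℕ} (Q : Fin k → ℝ) (E : Set (Fin k → ℝ)) (P : Fin k → ℝ) : Prop :=
  P ∈ E ∧ ∀ P' ∈ E, kl P Q ≤ kl P' Q

/-- The information projection `argmin_{P ∈ E} D(P ‖ Q)`. -/
def infoProj {k : ℕ} (Q : Fin k → ℝ) (E : Set (Fin k → ℝ)) : Fin k → ℝ :=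
  Classical.epsilon (IsInfoProj Q E)

/-- The tangent space `{v : 1ᵀ v = 0, A v = 0}`, where `A` has the columns `h x`. -/
def tangent {k d : ℕ} (h : Fin k → Fin d → ℝ) : Submodule ℝ (EuclideanSpace ℝ (Fin k)) where
  carrier := {v | ∑ x, v x = 0 ∧ ∑ x, v x • h x = 0}
  zero_mem' := by simp
  add_mem' := by
    rintro v w ⟨hv, hv'⟩ ⟨hw, hw'⟩
    constructor
    · simp [Finset.sum_add_distrib, hv, hw]
    · simp [add_smul, Finset.sum_add_distrib, hv', hw']
  smul_mem' := by
    rintro c v ⟨hv, hv'⟩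
    constructor
    · simp [← Finset.mul_sum, hv]
    · simp [mul_smul, ← Finset.smul_sum, hv']

/-- The projected Hessian `Π_T diag(1/P) Π_T`, as an operator on the tangent space `T`; in an
orthonormal basis `V` of `T` its matrix is `Vᵀ diag(1/P) V`. -/
def projHessian {k : ℕ} (T : Submodule ℝ (EuclideanSpace ℝ (Fin k))) (P : Fin k → ℝ) :
    T →ₗ[ℝ] T :=
  (T.orthogonalProjectionOnto : EuclideanSpace ℝ (Fin k) →ₗ[ℝ] T) ∘ₗ
    Matrix.toEuclideanLin (Matrix.diagonal fun x => 1 / P x) ∘ₗ T.subtype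

/-- The smallest eigenvalue of an operator with real spectrum on a nonzero finite-dimensional
real space. -/
def lambdaMin {V : Type*} [AddCommGroup V] [Module ℝ V] (H : V →ₗ[ℝ] V) : ℝ :=
  sInf {c : ℝ | Module.End.HasEigenvalue H c}

/-- The tangent space is spanned by its integer vectors (so that the types satisfying the
constraints form a lattice of full rank); this holds whenever `h` is rational valued. -/
def IsLatticeConstraint {k d : ℕ} (h : Fin k → Fin d → ℝ) : Prop :=
  Submodule.span ℝ {v | v ∈ tangent h ∧ ∀ x, ∃ z : ℤ, v x = z} = tangent h

/-- The empirical measure of a sample of size `n`. -/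
def empirical {k n : ℕ} (s : Fin n → Fin k) : Fin k → ℝ :=
  fun x => ((Finset.univ.filter fun i => s i = x).card : ℝ) / n

open Classical in
/-- `Pr((X_1, …, X_n) ∈ S)` for `X_1, …, X_n` i.i.d. with law `Q`. -/
def prob {k n : ℕ} (Q : Fin k → ℝ) (S : Set (Fin n → Fin k)) : ℝ :=
  ∑ s with s ∈ S, ∏ i, Q (s i)

/-- `Pr((X_1, …, X_n) ∈ S | (X_1, …, X_n) ∈ S')` for `X_1, …, X_n` i.i.d. with law `Q`. -/
def condProb {k n : ℕ} (Q : Fin k → ℝ) (S S' : Set (Fin n → Fin k)) : ℝ :=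
  prob Q (S ∩ S') / prob Q S'

open Classical in
/-- The feasible empirical types `E_n`: the members of `E` that are empirical measures of a
sample of size `n`. -/
def feasibleTypes {k : ℕ} (E : Set (Fin k → ℝ)) (n : ℕ) : Finset (Fin k → ℝ) :=
  ((Finset.univ : Finset (Fin n → Fin k)).image empirical).filter (· ∈ E)

/-- The event `X_{1:m} = y` for a sample of size `n ≥ m`. -/
def prefixEvent {k m : ℕ} (n : ℕ) (y : Fin m → Fin k) : Set (Fin n → Fin k) :=
  {s | ∀ (i : Fin n) (j : Fin m), (i : ℕ) = j → s i = y j}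

/-- The predictive law
`μ_{n,m}(y) = ∑_{P ∈ E_n} Pr(X_{1:m} = y | P_n = P) Pr(P_n = P | P_n ∈ E_n)`,
for `m ≤ n` and `E_n` nonempty. -/
def predictive {k : ℕ} (Q : Fin k → ℝ) (E : Set (Fin k → ℝ)) (n m : ℕ)
    (y : Fin m → Fin k) : ℝ :=
  ∑ P ∈ feasibleTypes E n,
    condProb Q (prefixEvent n y) {s | empirical s = P} *
      condProb Q {s : Fin n → Fin k | empirical s = P} {s | empirical s ∈ E}

/-- The product law `P^{⊗ m}`. -/
def productLaw {k : ℕ} (P : Fin k → ℝ) (m : ℕ) (y : Fin m → Fin k) : ℝ :=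
  ∏ j, P (y j)

/-- Total variation distance of two laws on a finite set. -/
def tvDist {ι : Type*} [Fintype ι] (μ ν : ι → ℝ) : ℝ :=
  (1 / 2) * ∑ y, |μ y - ν y|

/-- The filter `n → ∞` along the sample sizes for which the conditioning event is possible. -/
def feasibleAtTop {k : ℕ} (E : Set (Fin k → ℝ)) : Filter ℕ :=
  atTop ⊓ 𝓟 {n | (feasibleTypes E n).Nonempty}

end

end ConstrainedPrediction

open ConstrainedPrediction

namespace ConstrainedPrediction

/-! ### Relative entropy: scalar inequalities -/

/-! Write `R` for the information projection and `E` for the constraint set. First-order optimality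
makes `log (R / Q)` orthogonal to the tangent space, so on the event that the empirical measure lies
in `E` the likelihoods under `Q` and `R` are proportional (`productLaw_eq_mul_of_isInfoProj`).
Conditioning i.i.d. `Q` data on this event is therefore the same as conditioning i.i.d. `R` data.

The conditioned sample is exchangeable. Its prefix is a draw without replacement from the empirical
measure, hence within `m² / n` in total variation of the mixture of its product laws
(`sum_abs_prefix_sub_mixture_le`). Replacing the empirical measure by `R` costs at most `m` times
half their L1 distance, so it remains to show that the empirical measure concentrates at `R`.

Concentration is the method of types. A type `P` has probability at most `exp (-n kl P R)`, and
there are at most `(n + 1) ^ k` types. The conditioning event is only polynomially unlikely, because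
the lattice hypothesis supplies a feasible type within `O(1/n)` of `R` (`exists_near_type`,
`le_sum_productLaw_type`). Differences of points of `E` are tangent, so `kl P R` is at least `lam /
8` times the squared distance near `R` (`min_le_kl`, `lambdaMin_projHessian`). A radius of order
`√(log n / (n lam))`, with constant depending only on `k`, then beats all polynomial factors. -/

theorem sub_le_mul_log_div {p q : ℝ} (hp : 0 ≤ p) (hq : 0 < q) :
    p - q ≤ p * Real.log (p / q) := by
  rcases hp.eq_or_lt with rfl | hp
  · simp [hq.le]
  have h := Real.one_sub_inv_le_log_of_pos (div_pos hp hq)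
  have h2 := mul_le_mul_of_nonneg_left h hp.le
  have h3 : p * (1 - (p / q)⁻¹) = p - q := by field_simp
  linarith

/-- With `p = a²` and `q = b²`, the last factor dominates the Hellinger term `(a - b)²`, and `(a +
b)² ≤ 2 (a² + b²)`. -/
theorem sq_sub_le_mul_log_div {p q : ℝ} (hp : 0 < p) (hq : 0 < q) :
    (p - q) ^ 2 ≤ 2 * (p + q) * (p * Real.log (p / q) - p + q) := by
  obtain ⟨a, ha, rfl⟩ : ∃ a : ℝ, 0 < a ∧ p = a ^ 2 :=
    ⟨√p, Real.sqrt_pos.2 hp, (Real.sq_sqrt hp.le).symm⟩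
  obtain ⟨b, hb, rfl⟩ : ∃ b : ℝ, 0 < b ∧ q = b ^ 2 :=
    ⟨√q, Real.sqrt_pos.2 hq, (Real.sq_sqrt hq.le).symm⟩
  have h : (a - b) ^ 2 ≤ a ^ 2 * Real.log (a ^ 2 / b ^ 2) - a ^ 2 + b ^ 2 := by
    have h1 := mul_le_mul_of_nonneg_left (sub_le_mul_log_div ha.le hb) ha.le
    rw [← div_pow, Real.log_pow]
    push_cast
    nlinarith
  calc (a ^ 2 - b ^ 2) ^ 2 = (a + b) ^ 2 * (a - b) ^ 2 := by ring
    _ ≤ 2 * (a ^ 2 + b ^ 2) * (a - b) ^ 2 := by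
        gcongr
        nlinarith [sq_nonneg (a - b)]
    _ ≤ _ := by gcongr

variable {k d : ℕ}

/-- Convexity of `kl · Q`: the supporting hyperplane at `R`. -/
theorem kl_sub_kl_le {P R Q : Fin k → ℝ} (hP : ∀ x, 0 ≤ P x) (hR : ∀ x, 0 < R x)
    (hQ : ∀ x, 0 < Q x) (hsum : ∑ x, P x = ∑ x, R x) :
    kl R Q - kl P Q ≤ ∑ x, (R x - P x) * Real.log (R x / Q x) := by
  -- The gap between the two sides of the claim is exactly `kl P R`, nonnegative by this sum.
  have h : ∑ x, (P x - R x) ≤ ∑ x, P x * Real.log (P x / R x) :=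
    Finset.sum_le_sum fun x _ => sub_le_mul_log_div (hP x) (hR x)
  have h2 : ∀ x, P x * Real.log (P x / Q x)
      = P x * Real.log (P x / R x) + P x * Real.log (R x / Q x) := by
    intro x
    rcases (hP x).eq_or_lt with h0 | h0
    · simp [← h0]
    · rw [← mul_add, ← Real.log_mul (div_pos h0 (hR x)).ne' (div_pos (hR x) (hQ x)).ne',
        div_mul_div_cancel₀ (hR x).ne']
  rw [Finset.sum_sub_distrib, hsum, sub_self] at h
  unfold kl
  simp only [h2, sub_mul, Finset.sum_sub_distrib, Finset.sum_add_distrib]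
  linarith

/-! ### The information projection -/

/-- The closed constraint polytope. -/
def closedConstraintSet (h : Fin k → Fin d → ℝ) (a : Fin d → ℝ) : Set (Fin k → ℝ) :=
  {P | (∀ x, 0 ≤ P x) ∧ ∑ x, P x = 1 ∧ ∑ x, P x • h x = a}

theorem constraintSet_subset_closed (h : Fin k → Fin d → ℝ) (a : Fin d → ℝ) :
    constraintSet h a ⊆ closedConstraintSet h a :=
  fun _ hP => ⟨fun x => (hP.1 x).le, hP.2⟩

theorem le_one_of_mem_closed {h : Fin k → Fin d → ℝ} {a : Fin d → ℝ} {P : Fin k → ℝ}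
    (hP : P ∈ closedConstraintSet h a) (x : Fin k) : P x ≤ 1 :=
  hP.2.1 ▸ Finset.single_le_sum (fun y _ => hP.1 y) (Finset.mem_univ x)

theorem isCompact_closedConstraintSet (h : Fin k → Fin d → ℝ) (a : Fin d → ℝ) :
    IsCompact (closedConstraintSet h a) := by
  refine (isCompact_univ_pi fun _ : Fin k => isCompact_Icc (a := (0 : ℝ)) (b := 1)).of_isClosed_subset
    ?_ fun P hP x _ => ⟨hP.1 x, le_one_of_mem_closed hP x⟩
  have h1 : IsClosed {P : Fin k → ℝ | ∀ x, 0 ≤ P x} := by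
    rw [Set.ofPred_forall]
    exact isClosed_iInter fun x => isClosed_le continuous_const (continuous_apply x)
  exact h1.inter ((isClosed_eq (by fun_prop) continuous_const).inter
    (isClosed_eq (by fun_prop) continuous_const))

theorem continuous_kl_left {Q : Fin k → ℝ} (hQ : ∀ x, 0 < Q x) :
    Continuous fun P => kl P Q := by
  have h : ∀ x (p : ℝ), p * Real.log (p / Q x) = p * Real.log p - p * Real.log (Q x) := by
    intro x p
    rcases eq_or_ne p 0 with rfl | hp
    · simp
    · rw [Real.log_div hp (hQ x).ne', mul_sub]
  unfold kl
  simp only [h]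
  refine continuous_finsetSum _ fun x _ => ?_
  exact (Real.continuous_mul_log.comp (continuous_apply x)).sub (by fun_prop)

/-- The directional derivative inequality at a minimizer. -/
theorem sum_mul_log_nonneg_of_isMin {h : Fin k → Fin d → ℝ} {a : Fin d → ℝ}
    {Q P v : Fin k → ℝ} (hQ : ∀ x, 0 < Q x) (hP : P ∈ closedConstraintSet h a)
    (hmin : ∀ R ∈ constraintSet h a, kl P Q ≤ kl R Q) {t : ℝ} (ht : 0 < t)
    (hmem : P + t • v ∈ constraintSet h a) :
    0 ≤ ∑ x, v x * Real.log ((P x + t * v x) / Q x) := by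
  have h1 := hmin _ hmem
  -- The supporting hyperplane is taken at the perturbed point, which is interior; `P` itself may
  -- still lie on the boundary.
  have h2 := kl_sub_kl_le hP.1 hmem.1 hQ (hP.2.1.trans hmem.2.1.symm)
  have h3 : ∑ x, ((P + t • v) x - P x) * Real.log ((P + t • v) x / Q x)
      = t * ∑ x, v x * Real.log ((P x + t * v x) / Q x) := by
    rw [Finset.mul_sum]
    exact Finset.sum_congr rfl fun x _ => by simp [mul_assoc]
  rw [h3] at h2
  exact nonneg_of_mul_nonneg_right (by linarith) ht

/-- If `P x = 0`, moving towards an interior `R` gives a directional derivative with the term `R x *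
log (t * R x / Q x)`, which tends to `-∞` as `t → 0+`, while the other terms stay bounded above.
This contradicts minimality. -/
theorem pos_of_isMin {h : Fin k → Fin d → ℝ} {a : Fin d → ℝ}
    {Q P : Fin k → ℝ} (hQ : ∀ x, 0 < Q x) (hP : P ∈ closedConstraintSet h a)
    (hmin : ∀ R ∈ constraintSet h a, kl P Q ≤ kl R Q) (hne : (constraintSet h a).Nonempty)
    (x : Fin k) : 0 < P x := by
  obtain ⟨R, hR⟩ := hne
  by_contra hx
  have hx0 : P x = 0 := le_antisymm (not_lt.1 hx) (hP.1 x)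
  have hRx := hR.1 x
  have hmem : ∀ t : ℝ, 0 < t → t < 1 → P + t • (R - P) ∈ constraintSet h a := by
    intro t ht ht1
    refine ⟨fun y => ?_, ?_, ?_⟩
    · have := hP.1 y
      have := mul_pos ht (hR.1 y)
      simp only [Pi.add_apply, Pi.smul_apply, Pi.sub_apply, smul_eq_mul]
      nlinarith
    · simp [Finset.sum_add_distrib, ← Finset.mul_sum, hP.2.1, hR.2.1]
    · simp [add_smul, sub_smul, mul_smul, Finset.sum_add_distrib, ← Finset.smul_sum, hP.2.2,
        hR.2.2, Finset.sum_sub_distrib]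
  have key : Tendsto (fun t : ℝ => (∑ y ∈ Finset.univ.erase x,
      (R - P) y * Real.log ((P y + t * (R - P) y) / Q y))
      + (R - P) x * Real.log ((P x + t * (R - P) x) / Q x)) (nhdsWithin 0 (Set.Ioi 0)) atBot := by
    have hterm : ∀ y, ∃ B : ℝ, ∀ t : ℝ, 0 < t → t < 1 / 2 →
        (R - P) y * Real.log ((P y + t * (R - P) y) / Q y) ≤ B := by
      intro y
      -- The `R` part of the coefficient uses that the moving point is at most `1`; the `-P` part
      -- uses that it is at least `P y / 2`, whence `t < 1 / 2`.
      refine ⟨R y * |Real.log (1 / Q y)| - P y * Real.log (P y / 2 / Q y), fun t ht ht2 => ?_⟩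
      have hm := hmem t ht (by linarith)
      have hpos := hm.1 y
      have hle := le_one_of_mem_closed (constraintSet_subset_closed _ _ hm) y
      simp only [Pi.add_apply, Pi.smul_apply, Pi.sub_apply, smul_eq_mul] at hpos hle ⊢
      rw [sub_mul]
      have e1 : Real.log ((P y + t * (R y - P y)) / Q y) ≤ |Real.log (1 / Q y)| := by
        refine le_trans (Real.log_le_log (div_pos hpos (hQ y)) ?_) (le_abs_self _)
        exact div_le_div_of_nonneg_right hle (hQ y).le
      have e2 : P y * Real.log (P y / 2 / Q y) ≤ P y * Real.log ((P y + t * (R y - P y)) / Q y) := by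
        rcases (hP.1 y).eq_or_lt with h0 | h0
        · simp [← h0]
        · refine mul_le_mul_of_nonneg_left (Real.log_le_log ?_ ?_) h0.le
          · have := hQ y
            positivity
          · refine div_le_div_of_nonneg_right ?_ (hQ y).le
            have := mul_pos ht (hR.1 y)
            nlinarith
      have := mul_le_mul_of_nonneg_left e1 (hR.1 y).le
      linarith
    choose B hB using hterm
    refine tendsto_atBot_add_left_of_ge' _ (∑ y ∈ Finset.univ.erase x, B y) ?_ ?_
    · have : Set.Ioo (0 : ℝ) (1 / 2) ∈ nhdsWithin (0 : ℝ) (Set.Ioi 0) :=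
        Ioo_mem_nhdsGT (by norm_num)
      filter_upwards [this] with t ht
      exact Finset.sum_le_sum fun y _ => hB y t ht.1 ht.2
    · simp only [Pi.sub_apply, hx0, sub_zero, zero_add]
      refine Tendsto.const_mul_atBot hRx (Real.tendsto_log_nhdsGT_zero.comp ?_)
      refine tendsto_nhdsWithin_iff.2 ⟨?_, ?_⟩
      · have : Tendsto (fun t : ℝ => t * R x / Q x) (nhds 0) (nhds (0 * R x / Q x)) :=
          Continuous.tendsto (by fun_prop) 0
        rw [zero_mul, zero_div] at this
        exact this.mono_left nhdsWithin_le_nhds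
      · filter_upwards [self_mem_nhdsWithin] with t ht
        exact div_pos (mul_pos ht hRx) (hQ x)
  have h1 := key.eventually (eventually_lt_atBot 0)
  have h2 : Set.Ioo (0 : ℝ) 1 ∈ nhdsWithin (0 : ℝ) (Set.Ioi 0) := Ioo_mem_nhdsGT (by norm_num)
  obtain ⟨t, ht, ht01⟩ := (h1.and h2).exists
  have h3 := sum_mul_log_nonneg_of_isMin hQ hP hmin ht01.1 (hmem t ht01.1 ht01.2)
  rw [← Finset.sum_erase_add _ _ (Finset.mem_univ x)] at h3
  linarith

/-- A minimizer exists on the compact closed polytope and is interior by `pos_of_isMin`; this is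
what makes the `Classical.epsilon` choice meaningful. -/
theorem isInfoProj_infoProj {h : Fin k → Fin d → ℝ} {a : Fin d → ℝ} {Q : Fin k → ℝ}
    (hQ : ∀ x, 0 < Q x) (hne : (constraintSet h a).Nonempty) :
    IsInfoProj Q (constraintSet h a) (infoProj Q (constraintSet h a)) := by
  refine Classical.epsilon_spec (p := IsInfoProj Q (constraintSet h a)) ?_
  obtain ⟨P, hP, hmin⟩ := (isCompact_closedConstraintSet h a).exists_isMinOn
    (hne.mono (constraintSet_subset_closed h a)) (continuous_kl_left hQ).continuousOn
  have hmin' : ∀ R ∈ constraintSet h a, kl P Q ≤ kl R Q := fun R hR =>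
    hmin (constraintSet_subset_closed h a hR)
  exact ⟨P, ⟨pos_of_isMin hQ hP hmin' hne, hP.2⟩, hmin'⟩

theorem add_smul_mem_constraintSet {h : Fin k → Fin d → ℝ} {a : Fin d → ℝ} {P : Fin k → ℝ}
    (hP : P ∈ constraintSet h a) {v : EuclideanSpace ℝ (Fin k)} (hv : v ∈ tangent h) (t : ℝ)
    (hpos : ∀ x, 0 < P x + t * v x) : P + t • v.ofLp ∈ constraintSet h a := by
  refine ⟨hpos, ?_, ?_⟩
  · simp [Finset.sum_add_distrib, ← Finset.mul_sum, hP.2.1, hv.1]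
  · simp [add_smul, mul_smul, Finset.sum_add_distrib, ← Finset.smul_sum, hP.2.2, hv.2]

theorem sub_mem_tangent {h : Fin k → Fin d → ℝ} {a : Fin d → ℝ} {P R : Fin k → ℝ}
    (hP : P ∈ constraintSet h a) (hR : R ∈ constraintSet h a) :
    WithLp.toLp 2 (P - R) ∈ tangent h := by
  constructor
  · simp [Finset.sum_sub_distrib, hP.2.1, hR.2.1]
  · simp [sub_smul, Finset.sum_sub_distrib, hP.2.2, hR.2.2]

/-- First-order optimality of the information projection. -/
theorem IsInfoProj.sum_mul_log_eq_zero {h : Fin k → Fin d → ℝ} {a : Fin d → ℝ}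
    {Q P : Fin k → ℝ} (hQ : ∀ x, 0 < Q x) (hP : IsInfoProj Q (constraintSet h a) P)
    {v : EuclideanSpace ℝ (Fin k)} (hv : v ∈ tangent h) :
    ∑ x, v x * Real.log (P x / Q x) = 0 := by
  -- One-sided derivatives are nonnegative along every tangent direction; `v` and `-v` together
  -- force equality.
  have key : ∀ w ∈ tangent h, 0 ≤ ∑ x, w x * Real.log (P x / Q x) := by
    intro w hw
    have hlim : Tendsto (fun t : ℝ => ∑ x, w x * Real.log ((P x + t * w x) / Q x))
        (nhdsWithin 0 (Set.Ioi 0)) (nhds (∑ x, w x * Real.log (P x / Q x))) := by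
      refine tendsto_finsetSum _ fun x _ => Tendsto.const_mul _ ?_
      have h1 : Tendsto (fun t : ℝ => (P x + t * w x) / Q x) (nhds 0)
          (nhds ((P x + 0 * w x) / Q x)) := Continuous.tendsto (by fun_prop) 0
      rw [zero_mul, add_zero] at h1
      exact (h1.log (div_pos (hP.1.1 x) (hQ x)).ne').mono_left nhdsWithin_le_nhds
    have hpos : ∀ᶠ t : ℝ in nhdsWithin 0 (Set.Ioi 0), ∀ x, 0 < P x + t * w x := by
      rw [eventually_all]
      intro x
      have h1 : Tendsto (fun t : ℝ => P x + t * w x) (nhds 0) (nhds (P x + 0 * w x)) :=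
        Continuous.tendsto (by fun_prop) 0
      exact (h1.eventually_const_lt (by simpa using hP.1.1 x)).filter_mono nhdsWithin_le_nhds
    refine ge_of_tendsto hlim ?_
    filter_upwards [hpos, self_mem_nhdsWithin] with t ht ht0
    exact sum_mul_log_nonneg_of_isMin hQ (constraintSet_subset_closed _ _ hP.1) hP.2 ht0
      (add_smul_mem_constraintSet hP.1 hw t ht)
  refine le_antisymm ?_ (key v hv)
  have := key (-v) (neg_mem hv)
  simp only [PiLp.neg_apply, neg_mul, Finset.sum_neg_distrib] at this
  linarith

/-! ### Product laws and exchangeable sequences -/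

theorem sum_productLaw (P : Fin k → ℝ) (hP : ∑ x, P x = 1) (m : ℕ) :
    ∑ y, productLaw P m y = 1 := by
  unfold productLaw
  have h := Finset.prod_univ_sum (fun _ : Fin m => (Finset.univ : Finset (Fin k)))
    (fun _ x => P x)
  simp only [hP, Finset.prod_const_one, Fintype.piFinset_univ] at h
  exact h.symm

/-- Induction by splitting off the first coordinate: `P⊗A - R⊗B = (P - R)⊗A + R⊗(A - B)`. -/
theorem sum_abs_productLaw_sub_le {P R : Fin k → ℝ} (hP : IsProb P) (hR : IsProb R) (m : ℕ) :
    ∑ y, |productLaw P m y - productLaw R m y| ≤ m * ∑ x, |P x - R x| := by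
  induction m with
  | zero => simp [productLaw]
  | succ m ih =>
    have e : ∑ y : Fin (m + 1) → Fin k, |productLaw P (m + 1) y - productLaw R (m + 1) y|
        = ∑ z : Fin k × (Fin m → Fin k),
          |P z.1 * productLaw P m z.2 - R z.1 * productLaw R m z.2| := by
      refine (Fintype.sum_equiv (Fin.consEquiv fun _ => Fin k) _ _ fun z => ?_).symm
      simp [productLaw, Fin.prod_univ_succ, Fin.consEquiv]
    rw [e]
    have hprod : ∀ y, 0 ≤ productLaw P m y := fun y => Finset.prod_nonneg fun j _ => hP.1 _
    calc _ ≤ ∑ z : Fin k × (Fin m → Fin k), (|P z.1 - R z.1| * productLaw P m z.2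
            + R z.1 * |productLaw P m z.2 - productLaw R m z.2|) := by
          refine Finset.sum_le_sum fun z _ => ?_
          have h1 : P z.1 * productLaw P m z.2 - R z.1 * productLaw R m z.2
              = (P z.1 - R z.1) * productLaw P m z.2
                + R z.1 * (productLaw P m z.2 - productLaw R m z.2) := by ring
          rw [h1]
          refine (abs_add_le _ _).trans (le_of_eq ?_)
          rw [abs_mul, abs_mul, abs_of_nonneg (hprod z.2), abs_of_nonneg (hR.1 z.1)]
      _ = (∑ x, |P x - R x|) + ∑ y, |productLaw P m y - productLaw R m y| := by
          rw [Finset.sum_add_distrib]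
          congr 1
          · rw [Fintype.sum_prod_type]
            dsimp only
            rw [← Finset.sum_mul_sum, sum_productLaw P hP.2, mul_one]
          · rw [Fintype.sum_prod_type]
            dsimp only
            rw [← Finset.sum_mul_sum, hR.2, one_mul]
      _ ≤ _ := by push_cast; linarith

/-- The right side is the probability that `m` uniform draws with replacement from `n` items are
distinct. -/
theorem one_sub_le_descFactorial_div {n m : ℕ} (hn : 0 < n) (hmn : m ≤ n) :
    1 - (m : ℝ) ^ 2 / n ≤ (n.descFactorial m : ℝ) / (n : ℝ) ^ m := by
  have hn' : (0 : ℝ) < n := Nat.cast_pos.2 hn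
  induction m with
  | zero => simp
  | succ m ih =>
    have ih := ih (by omega)
    have hm : (m : ℝ) ≤ n := by exact_mod_cast (by omega : m ≤ n)
    have e : ((n.descFactorial (m + 1) : ℕ) : ℝ) / (n : ℝ) ^ (m + 1)
        = (1 - m / n) * ((n.descFactorial m : ℝ) / (n : ℝ) ^ m) := by
      rw [Nat.descFactorial_succ, Nat.cast_mul, Nat.cast_sub (by omega)]
      field_simp
      ring
    rw [e]
    have h0 : (0 : ℝ) ≤ 1 - m / n := by
      rw [sub_nonneg, div_le_one hn']; exact hm
    refine le_trans ?_ (mul_le_mul_of_nonneg_left ih h0)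
    have h1 : (0 : ℝ) ≤ (m / n) * ((m : ℝ) ^ 2 / n) := by positivity
    have h2 : ((m + 1 : ℕ) : ℝ) ^ 2 / n = (m : ℝ) ^ 2 / n + 2 * (m / n) + 1 / n := by
      push_cast; field_simp; ring
    have h3 : (0 : ℝ) ≤ m / n := by positivity
    have h4 : (0 : ℝ) ≤ 1 / n := by positivity
    rw [h2]
    nlinarith

theorem empirical_eq_sum {n : ℕ} (s : Fin n → Fin k) (x : Fin k) :
    empirical s x = (∑ i, if s i = x then (1 : ℝ) else 0) / n := by
  simp [empirical, Finset.sum_boole]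

theorem isProb_empirical {n : ℕ} (hn : 0 < n) (s : Fin n → Fin k) : IsProb (empirical s) := by
  refine ⟨fun x => by unfold empirical; positivity, ?_⟩
  have hn' : (n : ℝ) ≠ 0 := by positivity
  simp only [empirical_eq_sum, ← Finset.sum_div]
  rw [Finset.sum_comm]
  simp [hn']

/-- Sampling with replacement from the sample `s`. -/
theorem productLaw_empirical {n m : ℕ} (s : Fin n → Fin k) (y : Fin m → Fin k) :
    productLaw (empirical s) m y
      = (∑ f : Fin m → Fin n, if s ∘ f = y then (1 : ℝ) else 0) / (n : ℝ) ^ m := by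
  unfold productLaw
  simp only [empirical_eq_sum, Finset.prod_div_distrib, Finset.prod_const, Finset.card_univ,
    Fintype.card_fin]
  rw [Finset.prod_univ_sum, Fintype.piFinset_univ]
  congr 1
  refine Finset.sum_congr rfl fun f _ => ?_
  rw [Finset.prod_ite_zero]
  simp [funext_iff]

/-- An injective choice of positions can be carried to any other by a permutation, so an
exchangeable sample has the same law at any `m` distinct positions. -/
theorem sum_comp_perm {n : ℕ} {w : (Fin n → Fin k) → ℝ}
    (hinv : ∀ (σ : Equiv.Perm (Fin n)) s, w (s ∘ σ) = w s) {m : ℕ} {f g : Fin m → Fin n}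
    (hf : Function.Injective f) (hg : Function.Injective g) (y : Fin m → Fin k) :
    ∑ s, w s * (if s ∘ f = y then (1 : ℝ) else 0) = ∑ s, w s * (if s ∘ g = y then 1 else 0) := by
  obtain ⟨σ, hσ⟩ := Equiv.Perm.exists_extending_pair f g hf hg
  refine (Fintype.sum_equiv (σ.symm.arrowCongr (Equiv.refl (Fin k))) _ _ fun s => ?_).symm
  have e : (σ.symm.arrowCongr (Equiv.refl (Fin k))) s = s ∘ σ := by ext; simp
  rw [e, hinv]
  have e2 : (s ∘ σ) ∘ f = s ∘ g := by ext j; simp [hσ]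
  rw [e2]

/-- The prefix of an exchangeable sequence is close to the mixture of the product laws of its
empirical measure. -/
theorem sum_abs_prefix_sub_mixture_le {n m : ℕ} (hn : 0 < n) (hmn : m ≤ n)
    {w : (Fin n → Fin k) → ℝ} (hw : ∀ s, 0 ≤ w s) (hw1 : ∑ s, w s = 1)
    (hinv : ∀ (σ : Equiv.Perm (Fin n)) s, w (s ∘ σ) = w s) :
    ∑ y : Fin m → Fin k, |∑ s, w s * (if s ∘ Fin.castLE hmn = y then (1 : ℝ) else 0)
      - ∑ s, w s * productLaw (empirical s) m y| ≤ 2 * ((m : ℝ) ^ 2 / n) := by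
  classical
  set g : (Fin m → Fin n) → (Fin m → Fin k) → ℝ :=
    fun f y => ∑ s, w s * (if s ∘ f = y then (1 : ℝ) else 0) with hg
  have hg0 : ∀ f y, 0 ≤ g f y := fun f y =>
    Finset.sum_nonneg fun s _ => mul_nonneg (hw s) (by split_ifs <;> norm_num)
  have hg1 : ∀ f, ∑ y, g f y = 1 := by
    intro f
    rw [Finset.sum_comm]
    simp [hw1]
  set J := (Finset.univ : Finset (Fin m → Fin n)).filter Function.Injective with hJ
  have hJc : (J.card : ℝ) = n.descFactorial m := by
    have h := Fintype.card_embedding_eq (α := Fin m) (β := Fin n)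
    rw [Fintype.card_fin, Fintype.card_fin] at h
    rw [← h, ← Fintype.card_congr (Equiv.subtypeInjectiveEquivEmbedding (Fin m) (Fin n)),
      Fintype.card_subtype]
  have hn' : (0 : ℝ) < (n : ℝ) ^ m := by positivity
  have hI : (0 : ℝ) < J.card := by
    rw [hJc]; exact_mod_cast Nat.descFactorial_pos.2 hmn
  have hIle : (J.card : ℝ) ≤ (n : ℝ) ^ m := by
    rw [hJc]; exact_mod_cast Nat.descFactorial_le_pow n m
  have hcard : (Fintype.card (Fin m → Fin n) : ℝ) = (n : ℝ) ^ m := by simp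
  -- The prefix law is the uniform mixture of `g f` over injective `f`, and the product mixture
  -- (`e2`) is the uniform mixture over all `f`. Their L1 distance is at most that of the two
  -- uniform weights, which is `2 - 2 |J| / n ^ m`.
  have e1 : ∀ y, g (Fin.castLE hmn) y
      = ∑ f : Fin m → Fin n, (if f ∈ J then 1 / (J.card : ℝ) else 0) * g f y := by
    intro y
    simp only [ite_mul, zero_mul, Finset.sum_ite_mem, Finset.univ_inter]
    rw [Finset.sum_congr rfl fun f hf => by
      rw [show g f y = g (Fin.castLE hmn) y from
        sum_comp_perm hinv (Finset.mem_filter.1 hf).2 (Fin.castLE_injective hmn) y]]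
    rw [Finset.sum_const, nsmul_eq_mul]
    field_simp
  have e2 : ∀ y, ∑ s, w s * productLaw (empirical s) m y
      = ∑ f : Fin m → Fin n, 1 / (n : ℝ) ^ m * g f y := by
    intro y
    simp only [productLaw_empirical, hg, ← Finset.mul_sum]
    rw [Finset.sum_comm, Finset.mul_sum]
    refine Finset.sum_congr rfl fun s _ => ?_
    rw [← Finset.mul_sum]
    ring
  have e3 : ∀ y, |∑ s, w s * (if s ∘ Fin.castLE hmn = y then (1 : ℝ) else 0)
      - ∑ s, w s * productLaw (empirical s) m y|
      ≤ ∑ f : Fin m → Fin n, |(if f ∈ J then 1 / (J.card : ℝ) else 0) - 1 / (n : ℝ) ^ m|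
        * g f y := by
    intro y
    rw [e2 y, show (∑ s, w s * (if s ∘ Fin.castLE hmn = y then (1 : ℝ) else 0))
      = g (Fin.castLE hmn) y from rfl, e1 y, ← Finset.sum_sub_distrib]
    refine (Finset.abs_sum_le_sum_abs _ _).trans (Finset.sum_le_sum fun f _ => ?_)
    rw [← sub_mul, abs_mul, abs_of_nonneg (hg0 f y)]
  refine (Finset.sum_le_sum fun y _ => e3 y).trans ?_
  rw [Finset.sum_comm]
  simp only [← Finset.mul_sum, hg1, mul_one]
  have e4 : ∀ f, |(if f ∈ J then 1 / (J.card : ℝ) else 0) - 1 / (n : ℝ) ^ m|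
      = (if f ∈ J then 1 / (J.card : ℝ) - 2 / (n : ℝ) ^ m else 0) + 1 / (n : ℝ) ^ m := by
    intro f
    split_ifs
    · rw [abs_of_nonneg (sub_nonneg.2 (one_div_le_one_div_of_le hI hIle))]
      ring
    · rw [zero_sub, abs_neg, abs_of_pos (by positivity), zero_add]
  simp only [e4, Finset.sum_add_distrib, Finset.sum_ite_mem, Finset.univ_inter,
    Finset.sum_const, nsmul_eq_mul, Finset.card_univ, hcard]
  have h5 := one_sub_le_descFactorial_div hn hmn
  rw [← hJc] at h5
  have h6 : (J.card : ℝ) * (1 / J.card - 2 / (n : ℝ) ^ m) + (n : ℝ) ^ m * (1 / (n : ℝ) ^ m)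
      = 2 - 2 * (J.card / (n : ℝ) ^ m) := by
    field_simp
    ring
  rw [h6]
  linarith

/-! ### Probabilities of types -/

theorem sum_comp_eq_empirical {n : ℕ} (hn : 0 < n) (s : Fin n → Fin k) (g : Fin k → ℝ) :
    ∑ i, g (s i) = n * ∑ x, empirical s x * g x := by
  have hn' : (n : ℝ) ≠ 0 := by positivity
  simp only [empirical_eq_sum, div_mul_eq_mul_div, ← Finset.sum_div, Finset.sum_mul]
  rw [mul_div_cancel₀ _ hn', Finset.sum_comm]
  simp

theorem productLaw_eq_exp {n : ℕ} (hn : 0 < n) {R : Fin k → ℝ} (hR : ∀ x, 0 < R x)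
    (s : Fin n → Fin k) :
    productLaw R n s = Real.exp (n * ∑ x, empirical s x * Real.log (R x)) := by
  rw [← sum_comp_eq_empirical hn s fun x => Real.log (R x), Real.exp_sum]
  exact Finset.prod_congr rfl fun i _ => (Real.exp_log (hR _)).symm

theorem productLaw_eq_exp_neg_kl_mul {n : ℕ} (hn : 0 < n) {P R : Fin k → ℝ} (hP : ∀ x, 0 < P x)
    (hR : ∀ x, 0 < R x) {s : Fin n → Fin k} (hs : empirical s = P) :
    productLaw R n s = Real.exp (-(n * kl P R)) * productLaw P n s := by
  rw [productLaw_eq_exp hn hR, productLaw_eq_exp hn hP, ← Real.exp_add, hs]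
  congr 1
  have : kl P R = ∑ x, P x * Real.log (P x) - ∑ x, P x * Real.log (R x) := by
    unfold kl
    rw [← Finset.sum_sub_distrib]
    exact Finset.sum_congr rfl fun x _ => by
      rw [Real.log_div (hP x).ne' (hR x).ne', mul_sub]
  rw [this]
  ring

open Classical in
-- Changing measure from `R` to `P` multiplies each likelihood by the same exponential, and the type
-- class has `P`-probability at most one.
theorem sum_productLaw_type_le {n : ℕ} (hn : 0 < n) {P R : Fin k → ℝ} (hP : ∀ x, 0 < P x)
    (hP1 : ∑ x, P x = 1) (hR : ∀ x, 0 < R x) :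
    ∑ s : Fin n → Fin k with empirical s = P, productLaw R n s ≤ Real.exp (-(n * kl P R)) := by
  rw [Finset.sum_congr rfl fun s hs =>
    productLaw_eq_exp_neg_kl_mul hn hP hR (Finset.mem_filter.1 hs).2, ← Finset.mul_sum]
  refine mul_le_of_le_one_right (Real.exp_pos _).le ?_
  rw [← sum_productLaw P hP1 n]
  exact Finset.sum_le_sum_of_subset_of_nonneg (Finset.filter_subset _ _)
    fun s _ _ => Finset.prod_nonneg fun i _ => (hP _).le

/-- A crude Stirling bound, by induction from `(1 + 1/c) ^ (c + 1) ≥ e`. The factor `c + 1` in place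
of `c` covers `c = 0`. -/
theorem factorial_le_exp_mul (c : ℕ) :
    (c.factorial : ℝ) ≤ Real.exp 1 * (c + 1) * ((c : ℝ) ^ c / Real.exp c) := by
  have key : ∀ c : ℕ, 0 < c → (c.factorial : ℝ) ≤ Real.exp 1 * c * ((c : ℝ) ^ c / Real.exp c) := by
    intro c hc
    induction c, hc using Nat.le_induction with
    | base => simp
    | succ c hc ih =>
      have hc' : (0 : ℝ) < c := by exact_mod_cast hc
      have h2 : Real.exp 1 * (c : ℝ) ^ (c + 1) ≤ ((c : ℝ) + 1) ^ (c + 1) := by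
        have h3 := Real.one_sub_inv_le_log_of_pos (x := ((c : ℝ) + 1) / c) (by positivity)
        have h4 : (1 : ℝ) ≤ (c + 1 : ℕ) * Real.log (((c : ℝ) + 1) / c) := by
          have h5 : 1 - (((c : ℝ) + 1) / c)⁻¹ = 1 / (c + 1) := by field_simp; ring
          rw [h5, div_le_iff₀ (by positivity)] at h3
          push_cast
          linarith
        have h6 := Real.exp_le_exp.2 h4
        rw [← Real.log_pow, Real.exp_log (by positivity), div_pow,
          le_div_iff₀ (by positivity)] at h6
        exact h6
      rw [Nat.factorial_succ]
      push_cast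
      calc ((c : ℝ) + 1) * c.factorial
          ≤ (c + 1) * (Real.exp 1 * c * ((c : ℝ) ^ c / Real.exp c)) := by gcongr
        _ = (c + 1) * (Real.exp 1 * (c : ℝ) ^ (c + 1)) / Real.exp c := by ring
        _ ≤ (c + 1) * (((c : ℝ) + 1) ^ (c + 1)) / Real.exp c := by gcongr
        _ = _ := by rw [Real.exp_add]; field_simp
  rcases c.eq_zero_or_pos with rfl | hc
  · have := Real.add_one_le_exp (1 : ℝ)
    norm_num
  · refine (key c hc).trans ?_
    gcongr
    linarith

/-- Permutations map into the type class by `σ ↦ s ∘ σ`; each nonempty fibre translates into the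
stabilizer of `s`, whose order is the product of the factorials of the counts. -/
theorem factorial_le_card_type_mul {n : ℕ} (s : Fin n → Fin k) :
    n.factorial ≤ (∏ x, (Finset.univ.filter fun i => s i = x).card.factorial)
      * (Finset.univ.filter fun s' : Fin n → Fin k => empirical s' = empirical s).card := by
  classical
  have h := Finset.card_le_mul_card_image_of_maps_to (s := (Finset.univ : Finset (Equiv.Perm (Fin n))))
    (t := Finset.univ.filter fun s' : Fin n → Fin k => empirical s' = empirical s)
    (f := fun σ : Equiv.Perm (Fin n) => s ∘ σ) ?_ (∏ x, (Finset.univ.filter fun i => s i = x).card.factorial) ?_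
  · rwa [Finset.card_univ, Fintype.card_perm, Fintype.card_fin] at h
  · intro σ _
    simp only [Finset.mem_filter, Finset.mem_univ, true_and]
    ext x
    simp only [empirical_eq_sum]
    congr 1
    exact Equiv.sum_comp σ fun i => if s i = x then (1 : ℝ) else 0
  · intro b _
    have hst := DomMulAct.stabilizer_card s
    simp only [Fintype.card_subtype] at hst
    rw [← hst]
    rcases (Finset.univ.filter fun σ : Equiv.Perm (Fin n) => s ∘ σ = b).eq_empty_or_nonempty
      with h0 | ⟨τ, hτ⟩
    · rw [h0]; simp
    · have hτ' : s ∘ τ = b := (Finset.mem_filter.1 hτ).2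
      refine Finset.card_le_card_of_injOn (fun σ : Equiv.Perm (Fin n) => σ * τ⁻¹) ?_
        fun σ _ σ' _ h => mul_right_cancel h
      intro σ hσ
      have hσ' : s ∘ σ = b := by simpa using hσ
      simp only [Finset.coe_filter, Finset.mem_univ, true_and, Set.mem_ofPred_eq]
      rw [Equiv.Perm.coe_mul, ← Function.comp_assoc, hσ', ← hτ']
      ext i
      simp

/-- All members of the class are equally likely, so only its size matters. It is at least `n!` over
the product of the `c x !`, and Stirling costs a factor `e (n + 1)` per symbol. -/
theorem le_sum_productLaw_type {n : ℕ} (hn : 0 < n) {R : Fin k → ℝ} (hR : ∀ x, 0 < R x)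
    (s₀ : Fin n → Fin k) :
    Real.exp (-(n * kl (empirical s₀) R)) / (Real.exp 1 * (n + 1)) ^ k ≤
      ∑ s : Fin n → Fin k with empirical s = empirical s₀, productLaw R n s := by
  set c : Fin k → ℕ := fun x => (Finset.univ.filter fun i => s₀ i = x).card with hc
  have hn' : (0 : ℝ) < n := by exact_mod_cast hn
  have hsum : ∑ x, c x = n := by
    have := Finset.card_eq_sum_card_fiberwise (f := s₀) (s := Finset.univ) (t := Finset.univ)
      (fun _ _ => Finset.mem_univ _)
    simpa using this.symm
  have hcn : ∀ x, c x ≤ n := fun x => hsum ▸ Finset.single_le_sum (fun _ _ => Nat.zero_le _)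
    (Finset.mem_univ x)
  have e1 : ∑ s : Fin n → Fin k with empirical s = empirical s₀, productLaw R n s
      = (Finset.univ.filter fun s : Fin n → Fin k => empirical s = empirical s₀).card
        * productLaw R n s₀ := by
    rw [Finset.sum_congr rfl fun s hs => by
      rw [productLaw_eq_exp hn hR, (Finset.mem_filter.1 hs).2, ← productLaw_eq_exp hn hR]]
    simp
  have e2 : productLaw R n s₀ = ∏ x, R x ^ c x := by
    unfold productLaw
    rw [← Finset.prod_fiberwise (s := Finset.univ) (g := s₀)]
    refine Finset.prod_congr rfl fun x _ => ?_
    rw [Finset.prod_congr rfl fun i hi => by rw [(Finset.mem_filter.1 hi).2]]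
    simp [hc]
  have h1 : (n : ℝ) ^ n / Real.exp n ≤ (∏ x, ((c x).factorial : ℝ))
      * (Finset.univ.filter fun s : Fin n → Fin k => empirical s = empirical s₀).card := by
    have h2 : (n : ℝ) ^ n / Real.exp n ≤ n.factorial := by
      rw [div_le_iff₀ (Real.exp_pos _), ← div_le_iff₀' (by positivity)]
      exact Real.pow_div_factorial_le_exp _ hn'.le n
    refine h2.trans ?_
    exact_mod_cast factorial_le_card_type_mul s₀
  have h3 : ∏ x, ((c x).factorial : ℝ)
      ≤ (Real.exp 1 * (n + 1)) ^ k * ∏ x, ((c x : ℝ) ^ c x / Real.exp (c x)) := by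
    rw [show (Real.exp 1 * ((n : ℝ) + 1)) ^ k = ∏ _x : Fin k, (Real.exp 1 * ((n : ℝ) + 1)) by simp,
      ← Finset.prod_mul_distrib]
    refine Finset.prod_le_prod (fun x _ => by positivity) fun x _ => ?_
    refine (factorial_le_exp_mul (c x)).trans ?_
    have : (c x : ℝ) ≤ n := by exact_mod_cast hcn x
    gcongr
  have h4 : ∏ x, Real.exp (c x : ℝ) = Real.exp n := by
    rw [← Real.exp_sum, ← hsum]; push_cast; rfl
  have h5 : Real.exp (-(n * kl (empirical s₀) R)) * ∏ x, (c x : ℝ) ^ c x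
      = (n : ℝ) ^ n * ∏ x, R x ^ c x := by
    have : (n : ℝ) ^ n = ∏ x, (n : ℝ) ^ c x := by
      rw [Finset.prod_pow_eq_pow_sum, hsum]
    rw [this, ← Finset.prod_mul_distrib, kl, Finset.mul_sum, ← Finset.sum_neg_distrib,
      Real.exp_sum, ← Finset.prod_mul_distrib]
    refine Finset.prod_congr rfl fun x _ => ?_
    have hemp : empirical s₀ x = c x / n := rfl
    rcases Nat.eq_zero_or_pos (c x) with h0 | h0
    · simp [hemp, h0]
    · have h0' : (0 : ℝ) < c x := by exact_mod_cast h0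
      have e : -(n * (empirical s₀ x * Real.log (empirical s₀ x / R x)))
          = c x * Real.log (n * R x / c x) := by
        rw [hemp, show (n : ℝ) * R x / c x = ((c x / n : ℝ) / R x)⁻¹ by field_simp, Real.log_inv]
        field_simp
      have hRx := hR x
      rw [e, ← Real.log_pow, Real.exp_log (by positivity), div_pow, mul_pow]
      field_simp
  rw [e1, e2, div_le_iff₀ (by positivity)]
  set N : ℝ := ((Finset.univ.filter
    fun s : Fin n → Fin k => empirical s = empirical s₀).card : ℝ) with hNdef
  have hN : 0 ≤ N := Nat.cast_nonneg _
  have hcpos : 0 < ∏ x, (c x : ℝ) ^ c x := Finset.prod_pos fun x _ => by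
    rcases Nat.eq_zero_or_pos (c x) with h0 | h0
    · simp [h0]
    · positivity
  rw [Finset.prod_div_distrib, h4] at h3
  have h6 := h1.trans (mul_le_mul_of_nonneg_right h3 hN)
  have h7 : (n : ℝ) ^ n ≤ (Real.exp 1 * (n + 1)) ^ k * (∏ x, (c x : ℝ) ^ c x) * N := by
    rw [div_le_iff₀ (Real.exp_pos _)] at h6
    refine h6.trans (le_of_eq ?_)
    field_simp
  have hRpos : 0 ≤ ∏ x, R x ^ c x := Finset.prod_nonneg fun x _ => (pow_pos (hR x) _).le
  refine le_of_mul_le_mul_right ?_ hcpos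
  rw [h5]
  refine (mul_le_mul_of_nonneg_right h7 hRpos).trans (le_of_eq ?_)
  ring

theorem card_feasibleTypes_le (E : Set (Fin k → ℝ)) (n : ℕ) :
    (feasibleTypes E n).card ≤ (n + 1) ^ k := by
  classical
  refine (Finset.card_filter_le _ _).trans ?_
  have : (Finset.univ : Finset (Fin n → Fin k)).image empirical
      ⊆ (Finset.univ : Finset (Fin k → Fin (n + 1))).image fun c x => ((c x : ℕ) : ℝ) / n := by
    intro P hP
    obtain ⟨s, -, rfl⟩ := Finset.mem_image.1 hP
    refine Finset.mem_image.2 ⟨fun x => ⟨(Finset.univ.filter fun i => s i = x).card, ?_⟩,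
      Finset.mem_univ _, rfl⟩
    exact Nat.lt_succ_of_le ((Finset.card_filter_le _ _).trans (by simp))
  refine (Finset.card_le_card this).trans (Finset.card_image_le.trans ?_)
  simp

/-- A quadratic lower bound for the divergence. -/
theorem min_le_kl {P R : Fin k → ℝ} {p lam : ℝ} (hp : 0 < p) (hpR : ∀ x, p ≤ R x)
    (hP : ∀ x, 0 < P x) (hP1 : ∑ x, P x = 1) (hR1 : ∑ x, R x = 1)
    (hlam : lam * ∑ x, (P x - R x) ^ 2 ≤ ∑ x, (P x - R x) ^ 2 / R x) :
    min (p ^ 2 / 4) (lam / 8 * ∑ x, (P x - R x) ^ 2) ≤ kl P R := by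
  have hR : ∀ x, 0 < R x := fun x => hp.trans_le (hpR x)
  have hkl : kl P R = ∑ x, (P x * Real.log (P x / R x) - P x + R x) := by
    simp [kl, Finset.sum_add_distrib, Finset.sum_sub_distrib, hP1, hR1]
  have hnn : ∀ x, 0 ≤ P x * Real.log (P x / R x) - P x + R x := fun x => by
    have := sub_le_mul_log_div (hP x).le (hR x)
    linarith
  have hsq := fun x => sq_sub_le_mul_log_div (hP x) (hR x)
  have hle1 : ∀ {S : Fin k → ℝ}, (∀ x, 0 < S x) → ∑ x, S x = 1 → ∀ x, S x ≤ 1 :=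
    fun h0 h1 x => h1 ▸ Finset.single_le_sum (fun y _ => (h0 y).le) (Finset.mem_univ x)
  -- Far from `R`, the bound `P + R ≤ 2` suffices. Close to `R`, every coordinate differs by less
  -- than `p ≤ R x`, so `P ≤ 2 R` and `2 (P + R) ≤ 8 R`.
  rcases le_or_gt (p ^ 2) (∑ x, (P x - R x) ^ 2) with h | h
  · refine (min_le_left _ _).trans ?_
    have : (∑ x, (P x - R x) ^ 2) ≤ 4 * kl P R := by
      rw [hkl, Finset.mul_sum]
      refine Finset.sum_le_sum fun x _ => (hsq x).trans ?_
      refine mul_le_mul_of_nonneg_right ?_ (hnn x)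
      linarith [hle1 hP hP1 x, hle1 hR hR1 x]
    linarith
  · refine (min_le_right _ _).trans ?_
    have hPR : ∀ x, P x ≤ 2 * R x := by
      intro x
      have h1 : (P x - R x) ^ 2 ≤ ∑ x, (P x - R x) ^ 2 :=
        Finset.single_le_sum (f := fun x => (P x - R x) ^ 2) (fun y _ => sq_nonneg _)
          (Finset.mem_univ x)
      have h2 := abs_lt_of_sq_lt_sq (h1.trans_lt h) hp.le
      linarith [(abs_lt.1 h2).2, hpR x]
    have : ∑ x, (P x - R x) ^ 2 / R x ≤ 8 * kl P R := by
      rw [hkl, Finset.mul_sum]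
      refine Finset.sum_le_sum fun x _ => ?_
      rw [div_le_iff₀ (hR x)]
      refine (hsq x).trans ?_
      have := mul_le_mul_of_nonneg_right (hPR x) (hnn x)
      have := mul_nonneg (hR x).le (hnn x)
      nlinarith
    linarith

/-- The chi-square bound, from `log t ≤ t - 1`. It makes a type within `O(1/n)` of `R` have
divergence `O(1/n²)`. -/
theorem kl_le_sum_sq_div {P R : Fin k → ℝ} (hP : ∀ x, 0 < P x) (hR : ∀ x, 0 < R x)
    (hsum : ∑ x, P x = ∑ x, R x) : kl P R ≤ ∑ x, (P x - R x) ^ 2 / R x := by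
  have h : ∀ x, P x * Real.log (P x / R x) ≤ (P x - R x) ^ 2 / R x + (P x - R x) := by
    intro x
    have h1 := mul_le_mul_of_nonneg_left
      (Real.log_le_sub_one_of_pos (div_pos (hP x) (hR x))) (hP x).le
    refine h1.trans (le_of_eq ?_)
    have := (hR x).ne'
    field_simp
    ring
  refine (Finset.sum_le_sum fun x _ => h x).trans (le_of_eq ?_)
  rw [Finset.sum_add_distrib, Finset.sum_sub_distrib, hsum, sub_self, add_zero]

/-! ### Rounding to the lattice of types -/

/-- Extract a basis of integer vectors and take floors of the coefficients; the fractional parts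
leave an error of at most the sum of the basis norms. -/
theorem exists_integer_rounding {h : Fin k → Fin d → ℝ} (hlat : IsLatticeConstraint h) :
    ∃ B : ℝ, 0 ≤ B ∧ ∀ v ∈ tangent h, ∃ u ∈ tangent h, (∀ x, ∃ z : ℤ, u x = z) ∧
      ∀ x, |v x - u x| ≤ B := by
  classical
  set S : Set (EuclideanSpace ℝ (Fin k)) := {v | v ∈ tangent h ∧ ∀ x, ∃ z : ℤ, v x = z} with hS
  obtain ⟨b, hbS, hspan, hli⟩ := exists_linearIndependent ℝ S
  have hfin : b.Finite := hli.setFinite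
  obtain ⟨F, rfl⟩ := hfin.exists_finset_coe
  refine ⟨∑ a ∈ F, ‖a‖, Finset.sum_nonneg fun a _ => norm_nonneg a, fun v hv => ?_⟩
  rw [← show Submodule.span ℝ S = tangent h from hlat, ← hspan, Submodule.mem_span_finset] at hv
  obtain ⟨f, -, rfl⟩ := hv
  refine ⟨∑ a ∈ F, (⌊f a⌋ : ℝ) • a, Submodule.sum_mem _ fun a ha =>
    Submodule.smul_mem _ _ (hbS ha).1, fun x => ?_, fun x => ?_⟩
  · have : ∀ a ∈ F, ∃ z : ℤ, a x = z := fun a ha => (hbS ha).2 x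
    choose! z hz using this
    refine ⟨∑ a ∈ F, ⌊f a⌋ * z a, ?_⟩
    push_cast
    rw [WithLp.ofLp_sum, Finset.sum_apply]
    exact Finset.sum_congr rfl fun a ha => by simp [hz a ha]
  · have e : (∑ a ∈ F, f a • a) x - (∑ a ∈ F, (⌊f a⌋ : ℝ) • a) x
        = ∑ a ∈ F, Int.fract (f a) * a x := by
      rw [WithLp.ofLp_sum, Finset.sum_apply, WithLp.ofLp_sum, Finset.sum_apply,
        ← Finset.sum_sub_distrib]
      refine Finset.sum_congr rfl fun a _ => ?_
      simp only [PiLp.smul_apply, smul_eq_mul, ← sub_mul, Int.self_sub_floor]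
    rw [e]
    refine (Finset.abs_sum_le_sum_abs _ _).trans (Finset.sum_le_sum fun a _ => ?_)
    rw [abs_mul, abs_of_nonneg (Int.fract_nonneg _)]
    exact (mul_le_of_le_one_left (abs_nonneg _) (Int.fract_lt_one _).le).trans
      (PiLp.norm_apply_le a x)

theorem exists_sample_of_counts {n : ℕ} (c : Fin k → ℕ) (hc : ∑ x, c x = n) :
    ∃ s : Fin n → Fin k, ∀ x, empirical s x = c x / n := by
  have e : Fin n ≃ Σ x, Fin (c x) := Fintype.equivOfCardEq (by simp [hc])
  refine ⟨fun i => (e i).1, fun x => ?_⟩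
  unfold empirical
  congr 2
  rw [← Fintype.card_subtype, Fintype.card_congr
    (e.subtypeEquiv (q := fun a => a.1 = x) fun i => Iff.rfl),
    Fintype.card_congr (Equiv.sigmaSubtype x), Fintype.card_fin]

/-- Every interior point of the constraint set is within `O(1/n)` of a feasible type. -/
theorem exists_near_type {h : Fin k → Fin d → ℝ} (hlat : IsLatticeConstraint h) :
    ∃ B : ℝ, 0 ≤ B ∧ ∀ (a : Fin d → ℝ) (n : ℕ) (R : Fin k → ℝ), 0 < n → R ∈ constraintSet h a →
      (feasibleTypes (constraintSet h a) n).Nonempty → (∀ x, B / n < R x) →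
      ∃ s : Fin n → Fin k, empirical s ∈ constraintSet h a ∧
        ∀ x, |empirical s x - R x| ≤ B / n := by
  classical
  obtain ⟨B, hB, hround⟩ := exists_integer_rounding hlat
  refine ⟨B, hB, fun a n R hn hR hne hBR => ?_⟩
  have hn' : (0 : ℝ) < n := Nat.cast_pos.2 hn
  obtain ⟨P, hP⟩ := hne
  obtain ⟨hP1, hPE⟩ := Finset.mem_filter.1 hP
  obtain ⟨s₁, -, rfl⟩ := Finset.mem_image.1 hP1
  -- Starting from any feasible type, the displacement to `R` is scaled by `n` and rounded inside
  -- the tangent lattice, so adding `u / n` preserves both the constraints and the integrality of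
  -- counts.
  obtain ⟨u, hu, huz, huB⟩ := hround ((n : ℝ) • WithLp.toLp 2 (R - empirical s₁))
    (Submodule.smul_mem _ _ (sub_mem_tangent hR hPE))
  set P' : Fin k → ℝ := empirical s₁ + (1 / n : ℝ) • u.ofLp with hP'
  have hclose : ∀ x, |P' x - R x| ≤ B / n := by
    intro x
    have h1 := huB x
    have e : (P' x - R x) * n
        = -(((n : ℝ) • WithLp.toLp 2 (R - empirical s₁) : EuclideanSpace ℝ (Fin k)) x - u x) := by
      simp only [hP', Pi.add_apply, Pi.smul_apply, PiLp.smul_apply, smul_eq_mul, Pi.sub_apply]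
      field_simp
      ring
    have e' := congrArg abs e
    rw [abs_mul, abs_of_pos hn', abs_neg] at e'
    rwa [le_div_iff₀ hn', e']
  have hpos : ∀ x, 0 < empirical s₁ x + 1 / n * u x := fun x => by
    have h1 := (abs_le.1 (hclose x)).1
    have h2 := hBR x
    have h3 : P' x = empirical s₁ x + 1 / n * u x := rfl
    linarith
  have hE := add_smul_mem_constraintSet hPE hu (1 / n) hpos
  have hcount : ∀ x, ∃ c : ℕ, P' x = c / n := by
    intro x
    obtain ⟨z, hz⟩ := huz x
    have e : P' x = (((Finset.univ.filter fun i => s₁ i = x).card + z : ℤ) : ℝ) / n := by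
      simp only [hP', Pi.add_apply, Pi.smul_apply, smul_eq_mul, empirical, hz]
      push_cast
      ring
    have h0 : (0 : ℝ) < P' x := hpos x
    rw [e, div_pos_iff_of_pos_right hn', Int.cast_pos] at h0
    lift ((Finset.univ.filter fun i => s₁ i = x).card + z : ℤ) to ℕ using h0.le with c
    exact ⟨c, by rw [e]; push_cast; rfl⟩
  choose c hc using hcount
  have hcn : ∑ x, c x = n := by
    have h1 : ∑ x, P' x = 1 := hE.2.1
    simp only [hc, ← Finset.sum_div] at h1
    rw [div_eq_one_iff_eq hn'.ne'] at h1
    exact_mod_cast h1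
  obtain ⟨s, hs⟩ := exists_sample_of_counts c hcn
  have hsP : empirical s = P' := funext fun x => (hs x).trans (hc x).symm
  exact ⟨s, hsP ▸ hE, fun x => hsP ▸ hclose x⟩

/-! ### The smallest eigenvalue of the projected Hessian -/

theorem inner_projHessian (T : Submodule ℝ (EuclideanSpace ℝ (Fin k))) (R : Fin k → ℝ) (v w : T) :
    inner ℝ (projHessian T R v) w = ∑ x, (v : EuclideanSpace ℝ (Fin k)) x
      * (w : EuclideanSpace ℝ (Fin k)) x / R x := by
  have h := T.inner_orthogonalProjectionOnto_eq_of_mem_right w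
    (Matrix.toEuclideanLin (Matrix.diagonal fun x => 1 / R x) (v : EuclideanSpace ℝ (Fin k)))
  refine h.trans ?_
  rw [PiLp.inner_apply]
  refine Finset.sum_congr rfl fun x _ => ?_
  simp [Matrix.mulVec_diagonal]
  ring

theorem norm_sq_eq_sum (v : EuclideanSpace ℝ (Fin k)) : ‖v‖ ^ 2 = ∑ x, v x ^ 2 := by
  rw [EuclideanSpace.norm_sq_eq]
  simp

theorem isSymmetric_projHessian (T : Submodule ℝ (EuclideanSpace ℝ (Fin k))) (R : Fin k → ℝ) :
    (projHessian T R).IsSymmetric := by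
  intro v w
  rw [inner_projHessian, real_inner_comm, inner_projHessian]
  exact Finset.sum_congr rfl fun x _ => by ring

/-- The quadratic form has weights `1 / R x ≥ 1`. The bound keeps the `sInf` in `lambdaMin` from
being a default value. -/
theorem one_le_of_hasEigenvalue {T : Submodule ℝ (EuclideanSpace ℝ (Fin k))} {R : Fin k → ℝ}
    (hR : ∀ x, 0 < R x) (hR1 : ∀ x, R x ≤ 1) {c : ℝ}
    (hc : Module.End.HasEigenvalue (projHessian T R) c) : 1 ≤ c := by
  obtain ⟨v, hv⟩ := hc.exists_hasEigenvector
  have h1 := inner_projHessian T R v v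
  rw [hv.apply_eq_smul, inner_smul_left, real_inner_self_eq_norm_sq] at h1
  have h2 : ‖v‖ ^ 2 ≤ c * ‖v‖ ^ 2 := by
    refine le_of_le_of_eq ?_ h1.symm
    rw [show ‖v‖ = ‖(v : EuclideanSpace ℝ (Fin k))‖ from rfl, norm_sq_eq_sum]
    refine Finset.sum_le_sum fun x _ => ?_
    rw [le_div_iff₀ (hR x), ← sq]
    exact mul_le_of_le_one_right (sq_nonneg _) (hR1 x)
  have h3 : 0 < ‖v‖ ^ 2 := by
    have := norm_pos_iff.2 hv.2
    positivity
  nlinarith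

/-- For a symmetric operator on a nonzero finite-dimensional space the infimum of the Rayleigh
quotient is an eigenvalue, so `lambdaMin` is below every Rayleigh quotient. -/
theorem lambdaMin_projHessian {T : Submodule ℝ (EuclideanSpace ℝ (Fin k))} (hT : T ≠ ⊥)
    {R : Fin k → ℝ} (hR : ∀ x, 0 < R x) (hR1 : ∀ x, R x ≤ 1) :
    1 ≤ lambdaMin (projHessian T R) ∧
      ∀ v ∈ T, lambdaMin (projHessian T R) * ∑ x, v x ^ 2 ≤ ∑ x, v x ^ 2 / R x := by
  have := Submodule.nontrivial_iff_ne_bot.2 hT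
  have heig := (isSymmetric_projHessian T R).hasEigenvalue_iInf_of_finiteDimensional
  have hbdd : BddBelow {c : ℝ | Module.End.HasEigenvalue (projHessian T R) c} :=
    ⟨1, fun c hc => one_le_of_hasEigenvalue hR hR1 hc⟩
  refine ⟨le_csInf ⟨_, heig⟩ fun c hc => one_le_of_hasEigenvalue hR hR1 hc, fun v hv => ?_⟩
  rcases eq_or_ne v 0 with rfl | hv0
  · simp
  have hv0' : (⟨v, hv⟩ : T) ≠ 0 := by simpa [Subtype.ext_iff] using hv0
  have h1 := csInf_le hbdd heig
  have h2 : lambdaMin (projHessian T R) ≤ inner ℝ (projHessian T R ⟨v, hv⟩) ⟨v, hv⟩ / ‖v‖ ^ 2 := by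
    refine h1.trans (ciInf_le (f := fun x : {x : T // x ≠ 0} =>
      RCLike.re (inner ℝ (projHessian T R x.1) x.1) / ‖(x : T)‖ ^ 2) ⟨0, ?_⟩ ⟨⟨v, hv⟩, hv0'⟩)
    rintro _ ⟨w, rfl⟩
    refine div_nonneg ?_ (sq_nonneg _)
    rw [inner_projHessian, RCLike.re_to_real]
    exact Finset.sum_nonneg fun x _ => div_nonneg (mul_self_nonneg _) (hR x).le
  rw [inner_projHessian, le_div_iff₀ (by have := norm_pos_iff.2 hv0; positivity),
    norm_sq_eq_sum] at h2
  simpa only [← sq] using h2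

/-! ### The predictive law as an exchangeable mixture -/

open Classical in
/-- The law of the sample conditioned on the event that its empirical measure lies in `E`. -/
noncomputable def conditionalWeight (R : Fin k → ℝ) (E : Set (Fin k → ℝ)) (n : ℕ)
    (s : Fin n → Fin k) : ℝ :=
  if empirical s ∈ E then productLaw R n s / prob R {s : Fin n → Fin k | empirical s ∈ E} else 0

theorem productLaw_pos {R : Fin k → ℝ} (hR : ∀ x, 0 < R x) {n : ℕ} (s : Fin n → Fin k) :
    0 < productLaw R n s := Finset.prod_pos fun _ _ => hR _

theorem prob_pos {R : Fin k → ℝ} (hR : ∀ x, 0 < R x) {n : ℕ} {S : Set (Fin n → Fin k)}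
    (hS : S.Nonempty) : 0 < prob R S := by
  classical
  obtain ⟨s, hs⟩ := hS
  exact Finset.sum_pos (fun s _ => productLaw_pos hR s) ⟨s, by simpa using hs⟩

theorem mem_feasibleTypes {E : Set (Fin k → ℝ)} {n : ℕ} {P : Fin k → ℝ} :
    P ∈ feasibleTypes E n ↔ (∃ s : Fin n → Fin k, empirical s = P) ∧ P ∈ E := by
  classical
  simp [feasibleTypes]

theorem nonempty_event {E : Set (Fin k → ℝ)} {n : ℕ} (hne : (feasibleTypes E n).Nonempty) :
    {s : Fin n → Fin k | empirical s ∈ E}.Nonempty := by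
  obtain ⟨P, hP⟩ := hne
  obtain ⟨⟨s, rfl⟩, hs⟩ := mem_feasibleTypes.1 hP
  exact ⟨s, hs⟩

theorem conditionalWeight_nonneg {R : Fin k → ℝ} (hR : ∀ x, 0 < R x) (E : Set (Fin k → ℝ)) {n : ℕ}
    (s : Fin n → Fin k) : 0 ≤ conditionalWeight R E n s := by
  classical
  unfold conditionalWeight
  split_ifs with h
  · exact div_nonneg (productLaw_pos hR s).le (prob_pos hR ⟨s, h⟩).le
  · exact le_rfl

theorem sum_conditionalWeight {R : Fin k → ℝ} (hR : ∀ x, 0 < R x) {E : Set (Fin k → ℝ)} {n : ℕ}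
    (hne : (feasibleTypes E n).Nonempty) : ∑ s, conditionalWeight R E n s = 1 := by
  classical
  unfold conditionalWeight
  rw [← Finset.sum_filter, ← Finset.sum_div]
  exact div_self (prob_pos hR (nonempty_event hne)).ne'

theorem empirical_comp_perm {n : ℕ} (σ : Equiv.Perm (Fin n)) (s : Fin n → Fin k) :
    empirical (s ∘ σ) = empirical s := by
  ext x
  simp only [empirical_eq_sum]
  congr 1
  exact Equiv.sum_comp σ fun i => if s i = x then (1 : ℝ) else 0

theorem conditionalWeight_comp_perm (R : Fin k → ℝ) (E : Set (Fin k → ℝ)) {n : ℕ}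
    (σ : Equiv.Perm (Fin n)) (s : Fin n → Fin k) :
    conditionalWeight R E n (s ∘ σ) = conditionalWeight R E n s := by
  unfold conditionalWeight
  rw [empirical_comp_perm, show productLaw R n (s ∘ σ) = productLaw R n s from
    Equiv.prod_comp σ fun i => R (s i)]

/-- On the constraint event the laws of the sample under `Q` and under its information projection
are proportional. -/
theorem productLaw_eq_mul_of_isInfoProj {h : Fin k → Fin d → ℝ} {a : Fin d → ℝ} {Q R : Fin k → ℝ}
    (hQ : ∀ x, 0 < Q x) (hR : IsInfoProj Q (constraintSet h a) R) {n : ℕ} (hn : 0 < n)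
    {s : Fin n → Fin k} (hs : empirical s ∈ constraintSet h a) :
    productLaw Q n s = Real.exp (-(n * kl R Q)) * productLaw R n s := by
  have h1 := hR.sum_mul_log_eq_zero hQ (sub_mem_tangent hs hR.1)
  rw [productLaw_eq_exp hn hQ, productLaw_eq_exp hn hR.1.1, ← Real.exp_add]
  congr 1
  have h2 : ∀ x, Real.log (R x / Q x) = Real.log (R x) - Real.log (Q x) := fun x =>
    Real.log_div (hR.1.1 x).ne' (hQ x).ne'
  unfold kl
  simp only [h2, Pi.sub_apply, sub_mul, mul_sub, Finset.sum_sub_distrib] at h1 ⊢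
  have h3 : (n : ℝ) * (∑ x, empirical s x * Real.log (R x) - ∑ x, empirical s x * Real.log (Q x))
      = n * (∑ x, R x * Real.log (R x) - ∑ x, R x * Real.log (Q x)) := by
    congr 1
    linarith
  linarith

/-- The mixture over types telescopes to the prefix law given the event, and the constant factor
between `Q` and `R` likelihoods cancels in the ratio. -/
theorem predictive_eq_sum_conditionalWeight {h : Fin k → Fin d → ℝ} {a : Fin d → ℝ}
    {Q R : Fin k → ℝ} (hQ : ∀ x, 0 < Q x) (hR : IsInfoProj Q (constraintSet h a) R) {n m : ℕ}
    (hn : 0 < n) (hmn : m ≤ n) (y : Fin m → Fin k) :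
    predictive Q (constraintSet h a) n m y
      = ∑ s, conditionalWeight R (constraintSet h a) n s
        * (if s ∘ Fin.castLE hmn = y then (1 : ℝ) else 0) := by
  classical
  set E := constraintSet h a
  have hprob : ∀ S : Set (Fin n → Fin k), S ⊆ {s | empirical s ∈ E} →
      prob Q S = Real.exp (-(n * kl R Q)) * prob R S := by
    intro S hS
    unfold prob
    rw [Finset.mul_sum]
    exact Finset.sum_congr rfl fun s hs =>
      productLaw_eq_mul_of_isInfoProj hQ hR hn (hS (Finset.mem_filter.1 hs).2)
  have hterm : ∀ P ∈ feasibleTypes E n,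
      condProb Q (prefixEvent n y) {s | empirical s = P} *
        condProb Q {s : Fin n → Fin k | empirical s = P} {s | empirical s ∈ E}
      = prob R (prefixEvent n y ∩ {s | empirical s = P}) / prob R {s : Fin n → Fin k | empirical s ∈ E} := by
    intro P hP
    obtain ⟨⟨s, hs⟩, hPE⟩ := mem_feasibleTypes.1 hP
    have hsub : {s : Fin n → Fin k | empirical s = P} ⊆ {s | empirical s ∈ E} := by
      rintro s rfl
      exact hPE
    have h0 : prob Q {s : Fin n → Fin k | empirical s = P} ≠ 0 := (prob_pos hQ ⟨s, hs⟩).ne'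
    unfold condProb
    rw [Set.inter_eq_left.2 hsub, div_mul_div_cancel₀ h0, hprob _ Set.Subset.rfl,
      hprob _ (Set.inter_subset_right.trans hsub), mul_div_mul_left _ _ (Real.exp_pos _).ne']
  unfold predictive
  rw [Finset.sum_congr rfl hterm, ← Finset.sum_div]
  have hpre : ∀ s : Fin n → Fin k, s ∈ prefixEvent n y ↔ s ∘ Fin.castLE hmn = y := by
    intro s
    constructor
    · intro hs
      ext1 j
      exact hs _ j rfl
    · rintro rfl i j hij
      exact congrArg s (Fin.ext hij)
  have hsum : ∑ P ∈ feasibleTypes E n, prob R (prefixEvent n y ∩ {s | empirical s = P})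
      = ∑ s : Fin n → Fin k with empirical s ∈ E,
        productLaw R n s * (if s ∘ Fin.castLE hmn = y then (1 : ℝ) else 0) := by
    rw [← Finset.sum_fiberwise_of_maps_to (t := feasibleTypes E n) (g := empirical)
      fun s hs => mem_feasibleTypes.2 ⟨⟨s, rfl⟩, (Finset.mem_filter.1 hs).2⟩]
    refine Finset.sum_congr rfl fun P hP => ?_
    simp only [mul_ite, mul_one, mul_zero]
    rw [← Finset.sum_filter]
    unfold prob
    refine Finset.sum_congr ?_ fun s _ => rfl
    ext s
    have hPE := (mem_feasibleTypes.1 hP).2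
    simp only [Finset.mem_filter, Finset.mem_univ, true_and, Set.mem_inter_iff, hpre,
      Set.mem_ofPred_eq]
    constructor
    · rintro ⟨h1, rfl⟩
      exact ⟨⟨hPE, rfl⟩, h1⟩
    · rintro ⟨⟨_, h1⟩, h2⟩
      exact ⟨h2, h1⟩
  rw [hsum, Finset.sum_div, Finset.sum_filter]
  refine Finset.sum_congr rfl fun s _ => ?_
  unfold conditionalWeight
  split_ifs <;> simp

open Classical in
theorem sum_conditionalWeight_far_le {h : Fin k → Fin d → ℝ} {a : Fin d → ℝ}
    {R : Fin k → ℝ} (hR : R ∈ constraintSet h a) {p lam : ℝ} (hp : 0 < p)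
    (hpR : ∀ x, p ≤ R x) (hlam0 : 0 ≤ lam)
    (hlam : ∀ v ∈ tangent h, lam * ∑ x, v x ^ 2 ≤ ∑ x, v x ^ 2 / R x)
    {n : ℕ} (hn : 0 < n) {s₀ : Fin n → Fin k} (hs₀ : empirical s₀ ∈ constraintSet h a)
    (hkl : n * kl (empirical s₀) R ≤ 1) {r : ℝ} :
    ∑ s : Fin n → Fin k with r ^ 2 ≤ ∑ x, (empirical s x - R x) ^ 2,
        conditionalWeight R (constraintSet h a) n s
      ≤ Real.exp (k + 1) * (n + 1 : ℝ) ^ (2 * k)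
        * Real.exp (-(n * min (p ^ 2 / 4) (lam / 8 * r ^ 2))) := by
  set E := constraintSet h a with hE
  set M := min (p ^ 2 / 4) (lam / 8 * r ^ 2) with hM
  have hRpos : ∀ x, 0 < R x := hR.1
  -- The single type class of `s₀` already bounds the normalizing probability below.
  have hZ : Real.exp (-1) / (Real.exp 1 * (n + 1)) ^ k
      ≤ prob R {s : Fin n → Fin k | empirical s ∈ E} := by
    calc _ ≤ Real.exp (-(n * kl (empirical s₀) R)) / (Real.exp 1 * (n + 1)) ^ k := by gcongr
      _ ≤ _ := le_sum_productLaw_type hn hRpos s₀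
      _ ≤ _ := by
        refine Finset.sum_le_sum_of_subset_of_nonneg ?_ fun s _ _ => (productLaw_pos hRpos s).le
        intro s hs
        simp only [Finset.mem_filter, Finset.mem_univ, true_and, Set.mem_ofPred_eq] at hs ⊢
        rw [hs]
        exact hs₀
  have hZ0 : 0 < prob R {s : Fin n → Fin k | empirical s ∈ E} := prob_pos hRpos ⟨s₀, hs₀⟩
  set F := (feasibleTypes E n).filter fun P => r ^ 2 ≤ ∑ x, (P x - R x) ^ 2 with hF
  have hnum : ∑ s : Fin n → Fin k with r ^ 2 ≤ ∑ x, (empirical s x - R x) ^ 2 ∧ empirical s ∈ E,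
      productLaw R n s ≤ (n + 1 : ℝ) ^ k * Real.exp (-(n * M)) := by
    rw [← Finset.sum_fiberwise_of_maps_to (t := F) (g := empirical) fun s hs => by
      have hs' := (Finset.mem_filter.1 hs).2
      exact Finset.mem_filter.2 ⟨mem_feasibleTypes.2 ⟨⟨s, rfl⟩, hs'.2⟩, hs'.1⟩]
    calc _ ≤ ∑ P ∈ F, Real.exp (-(n * M)) := by
          refine Finset.sum_le_sum fun P hP => ?_
          obtain ⟨hP1, hPr⟩ := Finset.mem_filter.1 hP
          have hPE := (mem_feasibleTypes.1 hP1).2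
          refine le_trans ?_ ((sum_productLaw_type_le hn hPE.1 hPE.2.1 hRpos).trans ?_)
          · refine Finset.sum_le_sum_of_subset_of_nonneg ?_
              fun s _ _ => (productLaw_pos hRpos s).le
            intro s hs
            simp only [Finset.mem_filter, Finset.mem_univ, true_and] at hs ⊢
            exact hs.2
          · have h1 := min_le_kl hp hpR hPE.1 hPE.2.1 hR.2.1 (hlam _ (sub_mem_tangent hPE hR))
            have h2 : M ≤ min (p ^ 2 / 4) (lam / 8 * ∑ x, (P x - R x) ^ 2) :=
              min_le_min_left _ (by gcongr)
            have h3 := h2.trans h1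
            gcongr
      _ = F.card * Real.exp (-(n * M)) := by simp
      _ ≤ _ := by
          gcongr
          have := (Finset.card_filter_le (feasibleTypes E n) fun P =>
            r ^ 2 ≤ ∑ x, (P x - R x) ^ 2).trans (card_feasibleTypes_le E n)
          exact_mod_cast this
  have e1 : ∑ s : Fin n → Fin k with r ^ 2 ≤ ∑ x, (empirical s x - R x) ^ 2,
      conditionalWeight R E n s
      = (∑ s : Fin n → Fin k with r ^ 2 ≤ ∑ x, (empirical s x - R x) ^ 2 ∧ empirical s ∈ E,
        productLaw R n s) / prob R {s : Fin n → Fin k | empirical s ∈ E} := by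
    unfold conditionalWeight
    rw [← Finset.sum_filter, Finset.filter_filter, Finset.sum_div]
  rw [e1, div_le_iff₀ hZ0]
  refine hnum.trans ?_
  refine le_trans (le_of_eq ?_) (mul_le_mul_of_nonneg_left hZ (by positivity))
  have e2 : Real.exp (k + 1 : ℝ) * Real.exp (-1) = Real.exp 1 ^ k := by
    rw [← Real.exp_add, ← Real.exp_nat_mul]
    congr 1
    ring
  rw [mul_pow, ← e2]
  field_simp
  ring

theorem sum_abs_sub_le_two {P R : Fin k → ℝ} (hP : IsProb P) (hR : IsProb R) :
    ∑ x, |P x - R x| ≤ 2 := by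
  calc ∑ x, |P x - R x| ≤ ∑ x, (P x + R x) := Finset.sum_le_sum fun x _ => by
        rw [abs_le]
        constructor <;> linarith [hP.1 x, hR.1 x]
    _ = 2 := by rw [Finset.sum_add_distrib, hP.2, hR.2]; norm_num

theorem sum_abs_le_of_sum_sq_le {v : Fin k → ℝ} {r : ℝ} (hr : 0 ≤ r) (h : ∑ x, v x ^ 2 ≤ r ^ 2) :
    ∑ x, |v x| ≤ k * r := by
  calc ∑ x, |v x| ≤ ∑ _x : Fin k, r := Finset.sum_le_sum fun x _ =>
        abs_le_of_sq_le_sq ((Finset.single_le_sum (f := fun x => v x ^ 2)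
          (fun y _ => sq_nonneg _) (Finset.mem_univ x)).trans h) hr
    _ = k * r := by simp

open Classical in
-- Triangle inequality through the mixture of product laws. Types within Euclidean radius `r` have
-- L1 error at most `k * r`, the others at most `2`; the factor `1 / 2` of `tvDist` halves both.
theorem tvDist_predictive_le {h : Fin k → Fin d → ℝ} {a : Fin d → ℝ}
    {Q R : Fin k → ℝ} (hQ : ∀ x, 0 < Q x) (hR : IsInfoProj Q (constraintSet h a) R) {n m : ℕ}
    (hn : 0 < n) (hmn : m ≤ n) (hne : (feasibleTypes (constraintSet h a) n).Nonempty)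
    {r : ℝ} (hr : 0 ≤ r) :
    tvDist (predictive Q (constraintSet h a) n m) (productLaw R m) ≤ (m : ℝ) ^ 2 / n + m *
      (k * r / 2 + ∑ s : Fin n → Fin k with r ^ 2 ≤ ∑ x, (empirical s x - R x) ^ 2,
        conditionalWeight R (constraintSet h a) n s) := by
  set E := constraintSet h a
  set w := conditionalWeight R E n with hw
  have hw0 : ∀ s, 0 ≤ w s := conditionalWeight_nonneg hR.1.1 E
  have hw1 : ∑ s, w s = 1 := sum_conditionalWeight hR.1.1 hne
  have hRp : IsProb R := ⟨fun x => (hR.1.1 x).le, hR.1.2.1⟩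
  have h1 := sum_abs_prefix_sub_mixture_le hn hmn hw0 hw1 (conditionalWeight_comp_perm R E)
  have h2 : ∑ y, |∑ s, w s * productLaw (empirical s) m y - productLaw R m y|
      ≤ m * (k * r + 2 * ∑ s : Fin n → Fin k with r ^ 2 ≤ ∑ x, (empirical s x - R x) ^ 2, w s) := by
    calc _ ≤ ∑ y, ∑ s, w s * |productLaw (empirical s) m y - productLaw R m y| := by
          refine Finset.sum_le_sum fun y _ => ?_
          have e : ∑ s, w s * productLaw (empirical s) m y - productLaw R m y
              = ∑ s, w s * (productLaw (empirical s) m y - productLaw R m y) := by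
            simp only [mul_sub, Finset.sum_sub_distrib, ← Finset.sum_mul, hw1, one_mul]
          rw [e]
          refine (Finset.abs_sum_le_sum_abs _ _).trans (Finset.sum_le_sum fun s _ => ?_)
          rw [abs_mul, abs_of_nonneg (hw0 s)]
      _ = ∑ s, w s * ∑ y, |productLaw (empirical s) m y - productLaw R m y| := by
          rw [Finset.sum_comm]
          simp only [Finset.mul_sum]
      _ ≤ ∑ s, w s * (m * (k * r
            + if r ^ 2 ≤ ∑ x, (empirical s x - R x) ^ 2 then 2 else 0)) := by
          refine Finset.sum_le_sum fun s _ => mul_le_mul_of_nonneg_left ?_ (hw0 s)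
          refine (sum_abs_productLaw_sub_le (isProb_empirical hn s) hRp m).trans ?_
          refine mul_le_mul_of_nonneg_left ?_ (Nat.cast_nonneg _)
          split_ifs with hs
          · have := sum_abs_sub_le_two (isProb_empirical hn s) hRp
            have : 0 ≤ k * r := by positivity
            linarith
          · rw [add_zero]
            exact sum_abs_le_of_sum_sq_le hr (not_le.1 hs).le
      _ = _ := by
          rw [Finset.sum_filter, Finset.mul_sum, mul_add, Finset.mul_sum,
            ← one_mul ((m : ℝ) * (k * r)), ← hw1, Finset.sum_mul, ← Finset.sum_add_distrib]
          refine Finset.sum_congr rfl fun s _ => ?_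
          split_ifs <;> ring
  have h3 : ∑ y, |predictive Q E n m y - productLaw R m y|
      ≤ 2 * ((m : ℝ) ^ 2 / n) + m * (k * r
        + 2 * ∑ s : Fin n → Fin k with r ^ 2 ≤ ∑ x, (empirical s x - R x) ^ 2, w s) := by
    refine le_trans ?_ (add_le_add h1 h2)
    rw [← Finset.sum_add_distrib]
    refine Finset.sum_le_sum fun y _ => ?_
    rw [predictive_eq_sum_conditionalWeight hQ hR hn hmn y]
    exact abs_sub_le _ _ _
  unfold tvDist
  linarith

/-- The bound at a fixed sample size, with explicit largeness conditions. -/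
theorem tvDist_predictive_le_rate {h : Fin k → Fin d → ℝ} {a : Fin d → ℝ} {Q R : Fin k → ℝ}
    (hQ : ∀ x, 0 < Q x) (hR : IsInfoProj Q (constraintSet h a) R) {p lam : ℝ} (hp : 0 < p)
    (hpR : ∀ x, p ≤ R x) (hlam1 : 1 ≤ lam)
    (hlam : ∀ v ∈ tangent h, lam * ∑ x, v x ^ 2 ≤ ∑ x, v x ^ 2 / R x)
    {n m : ℕ} (hn : 0 < n) {s₀ : Fin n → Fin k} (hs₀ : empirical s₀ ∈ constraintSet h a)
    (hkl : n * kl (empirical s₀) R ≤ 1) (hlog : lam ≤ Real.log n)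
    (hlog2 : 2 * (k + 1) * Real.log n ≤ n * (p ^ 2 / 4))
    (hm : (m : ℝ) ≤ √(n * lam / Real.log n)) :
    tvDist (predictive Q (constraintSet h a) n m) (productLaw R m)
      ≤ (1 + 2 * k * √(k + 1) + 4 ^ k * Real.exp (k + 1))
        * (m * √(Real.log n / (n * lam))) := by
  have hn' : (0 : ℝ) < n := Nat.cast_pos.2 hn
  have hn1 : (1 : ℝ) ≤ n := by exact_mod_cast hn
  have hlog0 : 0 < Real.log n := by linarith
  have hlam0 : 0 < lam := by linarith
  set q := √(Real.log n / (n * lam)) with hq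
  have hq0 : 0 < q := Real.sqrt_pos.2 (by positivity)
  have hq2 : q ^ 2 = Real.log n / (n * lam) := Real.sq_sqrt (by positivity)
  -- This is where `lam ≤ log n` enters. With `m ≤ 1 / q` it gives `m ≤ n * q`, so the sampling
  -- error `m² / n` is absorbed by `m * q`.
  have hnq : 1 / n ≤ q ^ 2 := by
    rw [hq2, div_le_div_iff₀ hn' (by positivity)]
    nlinarith
  have hmq : (m : ℝ) ≤ 1 / q := by
    rwa [hq, ← Real.sqrt_one, ← Real.sqrt_div (by norm_num), one_div_div]
  have hinv : 1 / q ≤ n * q := by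
    rw [div_le_iff₀ hq0]
    rw [div_le_iff₀ hn'] at hnq
    linarith
  have hq1 : 1 / (n : ℝ) ^ 2 ≤ q := by
    refine (pow_le_pow_iff_left₀ (by positivity) hq0.le two_ne_zero).1 ?_
    refine le_trans ?_ hnq
    rw [div_pow, one_pow, ← pow_mul]
    exact one_div_le_one_div_of_le hn' (le_self_pow₀ hn1 (by norm_num))
  have hmn : m ≤ n := by
    have h1 : √(n * lam / Real.log n) ≤ n := by
      rw [Real.sqrt_le_left hn'.le, div_le_iff₀ hlog0]
      nlinarith [mul_le_mul_of_nonneg_left hlog hn'.le, mul_pos hn' hlog0]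
    exact_mod_cast hm.trans h1
  -- Chosen so that the exponent is `2 (k + 1) log n`: the tail `n ^ (-2k - 2)` beats the factor `(n
  -- + 1) ^ (2k)` and leaves `n ^ (-2) ≤ q`.
  set r := 4 * √((k : ℝ) + 1) * q with hr
  have hr0 : 0 ≤ r := by positivity
  have hr2 : n * (lam / 8 * r ^ 2) = 2 * (k + 1) * Real.log n := by
    rw [hr, mul_pow, mul_pow, Real.sq_sqrt (by positivity), hq2]
    field_simp
    ring
  have hne : (feasibleTypes (constraintSet h a) n).Nonempty :=
    ⟨_, mem_feasibleTypes.2 ⟨⟨s₀, rfl⟩, hs₀⟩⟩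
  have h1 := tvDist_predictive_le hQ hR hn hmn hne hr0
  have h2 := sum_conditionalWeight_far_le hR.1 hp hpR hlam0.le hlam hn hs₀ hkl (r := r)
  have h3 : Real.exp (-(n * min (p ^ 2 / 4) (lam / 8 * r ^ 2)))
      ≤ 1 / (n : ℝ) ^ (2 * k + 2) := by
    have e : 1 / (n : ℝ) ^ (2 * k + 2) = Real.exp (-(2 * (k + 1) * Real.log n)) := by
      rw [Real.exp_neg, one_div, show 2 * ((k : ℝ) + 1) * Real.log n
        = (2 * k + 2 : ℕ) * Real.log n by push_cast; ring, ← Real.log_pow,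
        Real.exp_log (by positivity)]
    rw [e, mul_min_of_nonneg _ _ hn'.le, hr2]
    exact Real.exp_le_exp.2 (neg_le_neg (le_min hlog2 le_rfl))
  have h4 : Real.exp (k + 1) * (n + 1 : ℝ) ^ (2 * k)
        * Real.exp (-(n * min (p ^ 2 / 4) (lam / 8 * r ^ 2))) ≤ 4 ^ k * Real.exp (k + 1) * q := by
    calc _ ≤ Real.exp (k + 1) * (2 * n : ℝ) ^ (2 * k) * (1 / (n : ℝ) ^ (2 * k + 2)) := by
          gcongr
          linarith
      _ = 4 ^ k * Real.exp (k + 1) * (1 / (n : ℝ) ^ 2) := by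
          rw [mul_pow, pow_mul 2 2 k, pow_add]
          field_simp
          norm_num
      _ ≤ _ := by gcongr
  have h5 : (m : ℝ) ^ 2 / n ≤ m * q := by
    rw [div_le_iff₀ hn', sq, mul_assoc]
    refine mul_le_mul_of_nonneg_left ?_ (Nat.cast_nonneg _)
    linarith
  refine h1.trans ?_
  have h6 := mul_le_mul_of_nonneg_left (h2.trans h4) (Nat.cast_nonneg (α := ℝ) m)
  have h7 : (k : ℝ) * r / 2 = 2 * k * √(k + 1) * q := by rw [hr]; ring
  rw [mul_add, h7]
  linarith

theorem tvDist_nonneg {ι : Type*} [Fintype ι] (μ ν : ι → ℝ) : 0 ≤ tvDist μ ν :=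
  mul_nonneg (by norm_num) (Finset.sum_nonneg fun _ _ => abs_nonneg _)

theorem exists_pos_le_of_pos {R : Fin k → ℝ} (hR : ∀ x, 0 < R x) : ∃ p, 0 < p ∧ ∀ x, p ≤ R x := by
  rcases isEmpty_or_nonempty (Fin k) with h | h
  · exact ⟨1, one_pos, fun x => h.elim x⟩
  · obtain ⟨x, hx⟩ := Finite.exists_min R
    exact ⟨R x, hR x, hx⟩

theorem tendsto_log_div_atTop : Tendsto (fun n : ℕ => Real.log n / n) atTop (nhds 0) :=
  (Real.isLittleO_log_id_atTop.tendsto_div_nhds_zero).comp tendsto_natCast_atTop_atTop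

/-- For all large feasible sample sizes some feasible type has bounded rescaled divergence from
the given interior point. -/
theorem eventually_exists_near_type {h : Fin k → Fin d → ℝ} (hlat : IsLatticeConstraint h)
    {a : Fin d → ℝ} {R : Fin k → ℝ} (hR : R ∈ constraintSet h a) :
    ∀ᶠ n : ℕ in feasibleAtTop (constraintSet h a), ∃ s : Fin n → Fin k,
      empirical s ∈ constraintSet h a ∧ n * kl (empirical s) R ≤ 1 := by
  obtain ⟨p, hp, hpR⟩ := exists_pos_le_of_pos hR.1
  obtain ⟨B, hB, hnear⟩ := exists_near_type hlat
  have e1 : ∀ᶠ n : ℕ in atTop, B / n < p :=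
    (tendsto_const_div_atTop_nhds_zero_nat B).eventually_lt_const hp
  have e2 : ∀ᶠ n : ℕ in atTop, k * B ^ 2 / p / n < 1 :=
    (tendsto_const_div_atTop_nhds_zero_nat _).eventually_lt_const one_pos
  refine eventually_inf_principal.2 ?_
  filter_upwards [e1, e2, eventually_gt_atTop 0] with n h1 h2 hn hne
  obtain ⟨s, hs, hsB⟩ := hnear a n R hn hR hne fun x => h1.trans_le (hpR x)
  refine ⟨s, hs, ?_⟩
  have hn' : (0 : ℝ) < n := Nat.cast_pos.2 hn
  have h3 := kl_le_sum_sq_div hs.1 hR.1 (hs.2.1.trans hR.2.1.symm)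
  -- Each coordinate is off by at most `B / n`, so `n * kl` is `O(1/n)`.
  have h4 : ∑ x, (empirical s x - R x) ^ 2 / R x ≤ ∑ _x : Fin k, (B / n) ^ 2 / p := by
    refine Finset.sum_le_sum fun x _ => ?_
    have := sq_le_sq' (abs_le.1 (hsB x)).1 (abs_le.1 (hsB x)).2
    exact div_le_div₀ (sq_nonneg _) this hp (hpR x)
  calc n * kl (empirical s) R ≤ n * ∑ _x : Fin k, (B / n) ^ 2 / p := by
        have := h3.trans h4
        gcongr
    _ = k * B ^ 2 / p / n := by
        simp only [Finset.sum_const, Finset.card_univ, Fintype.card_fin, nsmul_eq_mul]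
        field_simp
    _ ≤ 1 := h2.le

end ConstrainedPrediction

theorem mainTheorem9 (k : ℕ) :
    ∃ C : ℝ, 0 < C ∧
      ∀ (d p : ℕ) (h : Fin k → Fin d → ℝ) (Θ : Set (EuclideanSpace ℝ (Fin p)))
        (α : EuclideanSpace ℝ (Fin p) → Fin d → ℝ) (Q P₀ : Fin k → ℝ)
        (θ₀ : EuclideanSpace ℝ (Fin p)),
        tangent h ≠ ⊥ → IsLatticeConstraint h →
        (∀ x, 0 < Q x) → IsProb Q → IsProb P₀ →
        (∀ θ ∈ Θ, (constraintSet h (α θ)).Nonempty) →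
        θ₀ ∈ Θ →
        IsMinOn (fun θ => kl P₀ (infoProj Q (constraintSet h (α θ)))) Θ θ₀ →
        ∀ (Pstar : Fin k → ℝ) (lam : ℝ),
          Pstar = infoProj Q (constraintSet h (α θ₀)) →
          lam = lambdaMin (projHessian (tangent h) Pstar) →
          ∀ m : ℕ → ℕ,
            (fun n => (m n : ℝ)) =o[feasibleAtTop (constraintSet h (α θ₀))]
              (fun n : ℕ => √((n : ℝ) * lam / Real.log n)) →
            (∀ᶠ n : ℕ in feasibleAtTop (constraintSet h (α θ₀)),
              tvDist (predictive Q (constraintSet h (α θ₀)) n (m n)) (productLaw Pstar (m n))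
                ≤ C * ((m n : ℝ) * √(Real.log n / ((n : ℝ) * lam)))) ∧
            Tendsto
              (fun n => tvDist (predictive Q (constraintSet h (α θ₀)) n (m n))
                (productLaw Pstar (m n)))
              (feasibleAtTop (constraintSet h (α θ₀))) (nhds 0) := by
  refine ⟨1 + 2 * k * √(k + 1) + 4 ^ k * Real.exp (k + 1), by positivity, ?_⟩
  intro d p h Θ α Q P₀ θ₀ hT hlat hQ _ _ hne hθ₀ _ Pstar lam hPstar hlam m hm
  have hproj : IsInfoProj Q (constraintSet h (α θ₀)) Pstar :=
    hPstar ▸ isInfoProj_infoProj hQ (hne θ₀ hθ₀)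
  obtain ⟨q, hq, hqP⟩ := exists_pos_le_of_pos hproj.1.1
  obtain ⟨hlam1, hlamT⟩ := lambdaMin_projHessian hT hproj.1.1
    (le_one_of_mem_closed (constraintSet_subset_closed _ _ hproj.1))
  rw [← hlam] at hlam1 hlamT
  have hlog : Tendsto (fun n : ℕ => Real.log n) atTop atTop :=
    Real.tendsto_log_atTop.comp tendsto_natCast_atTop_atTop
  have hle : feasibleAtTop (constraintSet h (α θ₀)) ≤ atTop := inf_le_left
  have hbound : ∀ᶠ n : ℕ in feasibleAtTop (constraintSet h (α θ₀)),
      tvDist (predictive Q (constraintSet h (α θ₀)) n (m n)) (productLaw Pstar (m n))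
        ≤ (1 + 2 * k * √(k + 1) + 4 ^ k * Real.exp (k + 1))
          * ((m n : ℝ) * √(Real.log n / ((n : ℝ) * lam))) := by
    -- This threshold makes the quadratic term the smaller one in the minimum of `min_le_kl`, so `q`
    -- affects only how large `n` must be and not the constant.
    have e1 : ∀ᶠ n : ℕ in atTop, Real.log n / n < q ^ 2 / 4 / (2 * (k + 1)) :=
      tendsto_log_div_atTop.eventually_lt_const (by positivity)
    filter_upwards [eventually_exists_near_type hlat hproj.1, hm.bound one_pos,
      hle (hlog.eventually_ge_atTop lam), hle e1, hle (eventually_gt_atTop 0)]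
      with n hs hmn hn1 hn2 hn
    obtain ⟨s, hsE, hskl⟩ := hs
    have hn' : (0 : ℝ) < n := Nat.cast_pos.2 hn
    refine tvDist_predictive_le_rate hQ hproj hq hqP hlam1 hlamT hn hsE hskl hn1 ?_ ?_
    · rw [div_lt_div_iff₀ hn' (by positivity)] at hn2
      linarith
    · simpa [abs_of_nonneg (Real.sqrt_nonneg _)] using hmn
  refine ⟨hbound, ?_⟩
  have hlim : Tendsto (fun n : ℕ => (1 + 2 * k * √(k + 1) + 4 ^ k * Real.exp (k + 1))
      * ((m n : ℝ) * √(Real.log n / ((n : ℝ) * lam))))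
      (feasibleAtTop (constraintSet h (α θ₀))) (nhds 0) := by
    -- The bound is a constant times `m / √(n lam / log n)`, which the little-o hypothesis sends to
    -- zero.
    have h1 := hm.tendsto_div_nhds_zero.const_mul
      (1 + 2 * k * √(k + 1) + 4 ^ k * Real.exp (k + 1))
    rw [mul_zero] at h1
    refine h1.congr fun n => ?_
    rw [div_eq_mul_inv, ← Real.sqrt_inv, inv_div]
  exact squeeze_zero' (Eventually.of_forall fun n => tvDist_nonneg _ _) hbound hlim
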